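/- Let $G$ be a Lie group and let $M$ be a complete (finite-dimensional, smooth, without boundary) Riemannian manifold on which $G$ acts smoothly, properly and by isometries. Assume that the orbit space $M/G$ is connected (for example, that $M$ is connected) and not compact. Call $K\subseteq M$ *cocompact* if its image in $M/G$ has compact closure, and say that a function $\varphi\colon M\to[0,\infty)$ *tends to $0$ transversally* if for every $\varepsilon>0$ there is a cocompact $K\subseteq M$ with $\varphi<\varepsilon$ on $M\setminus K$. Let $C_b^G(M)$ be the algebra of bounded continuous $G$-invariant functions $M\to\mathbb{C}$ with the supremum norm, let $C_0^G(M)\subseteq C_b^G(M)$ consist of the functions $f$ for which $|f|$ tends to $0$ transversally, let $C_g^{\infty,G}(M)\subseteq C_b^G(M)$ consist of the smooth functions $f$ for which $\|df\|_{T^*M}$ tends to $0$ transversally, and let $C_g^G(M)$ be the closure of $C_g^{\infty,G}(M)$ in $C_b^G(M)$. Then $C_0^G(M)$ is a closed ideal of $C_g^G(M)$; put $C(\partial_h^G\overline{M})=C_g^G(M)/C_0^G(M)$, and let the *Higson $G$-corona* $\partial_h^G\overline{M}$ of $M$ be its maximal ideal space. For a commutative unital Banach algebra $A$ let $K_0(A)$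 be the Grothendieck group of the semigroup of equivalence classes of idempotent matrices over $A$, let $K_1(A)=GL_\infty(A)/GL_\infty(A)_0$, where $GL_\infty(A)_0$ is the path component of the identity, and for a compact Hausdorff space $X$ let $K^*(X)=K_0(C(X))\oplus K_1(C(X))$. **Theorem.** The K-theory $K^*(\partial_h^G\overline{M})$ of the Higson $G$-corona of $M$ is uncountable. Moreover, the groups $K_1(C(\partial_h^G\overline{M}))=K_1\big(C_g^G(M)/C_0^G(M)\big)$ and $K_1(C_g^G(M))$ are uncountable. -/

import Mathlib

open scoped Manifold ContDiff Bundle Matrix BoundedContinuousFunction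

noncomputable section

/-! ### Topological K-theory of commutative unital Banach algebras -/

namespace KTheory

section K1

variable (A : Type*) [CommRing A]

/-- The block sum `U ⊕ 1`, from `n × n` to `m × m` matrices, where `n ≤ m`. -/
def padMatrix {n m : ℕ} (U : Matrix (Fin n) (Fin n) A) : Matrix (Fin m) (Fin m) A :=
  fun i j => if h : (i : ℕ) < n ∧ (j : ℕ) < n then U ⟨i, h.1⟩ ⟨j, h.2⟩ else if i = j then 1 else 0

variable {A}

theorem padMatrix_one {n m : ℕ} :
    padMatrix A (m := m) (1 : Matrix (Fin n) (Fin n) A) = 1 := by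
  ext i j
  by_cases h : (i : ℕ) < n ∧ (j : ℕ) < n
  · simp [padMatrix, h, Matrix.one_apply, Fin.ext_iff]
  · simp [padMatrix, h, Matrix.one_apply]

theorem padMatrix_mul {n m : ℕ} (h : n ≤ m) (U V : Matrix (Fin n) (Fin n) A) :
    padMatrix A (m := m) (U * V) = padMatrix A U * padMatrix A V := by
  obtain ⟨k, rfl⟩ := Nat.exists_eq_add_of_le h
  ext i j
  rw [Matrix.mul_apply, Fin.sum_univ_add]
  refine Fin.addCases (fun i => ?_) (fun i => ?_) i <;>
    refine Fin.addCases (fun j => ?_) (fun j => ?_) j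
  · have h1 : ∀ x : Fin k, (n + (x : ℕ) = (j : ℕ)) ↔ False := fun x => by
      have := j.2
      constructor
      · intro; omega
      · exact False.elim
    simp [padMatrix, Matrix.mul_apply, Fin.ext_iff, h1]
  · have h1 : ∀ x : Fin n, ((x : ℕ) = n + (j : ℕ)) ↔ False := fun x => by
      have := x.2
      constructor
      · intro; omega
      · exact False.elim
    have h2 : ∀ x : Fin k, ((i : ℕ) = n + (x : ℕ)) ↔ False := fun x => by
      have := i.2
      constructor
      · intro; omega
      · exact False.elim
    simp [padMatrix, Fin.ext_iff, h1, h2]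
  · have h1 : ∀ x : Fin n, (n + (i : ℕ) = (x : ℕ)) ↔ False := fun x => by
      have := x.2
      constructor
      · intro; omega
      · exact False.elim
    have h2 : ∀ x : Fin k, (n + (x : ℕ) = (j : ℕ)) ↔ False := fun x => by
      have := j.2
      constructor
      · intro; omega
      · exact False.elim
    simp [padMatrix, Fin.ext_iff, h1, h2]
  · have h1 : ∀ x : Fin n, (n + (i : ℕ) = (x : ℕ)) ↔ False := fun x => by
      have := x.2
      constructor
      · intro; omega
      · exact False.elim
    simp [padMatrix, Fin.ext_iff, h1]
    simp [← Fin.ext_iff]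

variable (A)

/-- The inclusion `GL_n(A) → GL_m(A)`, `U ↦ U ⊕ 1`, for `n ≤ m`. -/
def glPad (n m : ℕ) (h : n ≤ m) : GL (Fin n) A →* GL (Fin m) A :=
  Units.map
    { toFun := padMatrix A
      map_one' := padMatrix_one
      map_mul' := padMatrix_mul h }

instance glPad_directedSystem :
    DirectedSystem (fun n : ℕ => GL (Fin n) A) (fun n m h => glPad A n m h) where
  map_self n U := by
    ext i j
    simp [glPad, padMatrix]
  map_map k j i hij hjk U := by
    ext a b
    by_cases h : (a : ℕ) < i ∧ (b : ℕ) < i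
    · have h1 := h.1.trans_le hij
      have h2 := h.2.trans_le hij
      simp [glPad, padMatrix, h, h1, h2]
    · simp [glPad, padMatrix, h, Fin.ext_iff]

/-- `GL_∞(A)`, the union of the groups `GL_n(A)` along `U ↦ U ⊕ 1`. -/
abbrev GLInf : Type _ := DirectLimit (fun n : ℕ => GL (Fin n) A) (glPad A)

/-- The canonical homomorphism `GL_n(A) → GL_∞(A)`. -/
def glToInf (n : ℕ) : GL (Fin n) A →* GLInf A where
  toFun U := ⟦⟨n, U⟩⟧
  map_one' := (DirectLimit.one_def n).symm
  map_mul' U V := (DirectLimit.mul_def (f := glPad A) n U V).symm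

/-- The path component of the identity of a topological group. -/
def pathComponentOne (Γ : Type*) [TopologicalSpace Γ] [Group Γ] [IsTopologicalGroup Γ] :
    Subgroup Γ where
  carrier := {g | Joined 1 g}
  one_mem' := Joined.refl 1
  mul_mem' := by
    rintro a b ⟨p⟩ ⟨q⟩
    exact ⟨(p.mul q).cast (by simp) (by simp)⟩
  inv_mem' := by
    rintro a ⟨p⟩
    exact ⟨(p.map continuous_inv).cast (by simp) (by simp)⟩

variable [TopologicalSpace A] [IsTopologicalRing A]

/-- `GL_∞(A)_0`: the elements represented by some `U ∈ GL_n(A)` that is joined to `1` by a path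
in `GL_n(A)`. -/
def GLInfZero : Subgroup (GLInf A) :=
  ⨆ n : ℕ, (pathComponentOne (GL (Fin n) A)).map (glToInf A n)

variable {A} in
theorem continuous_padMatrix {n m : ℕ} :
    Continuous (padMatrix A : Matrix (Fin n) (Fin n) A → Matrix (Fin m) (Fin m) A) := by
  refine continuous_pi fun i => continuous_pi fun j => ?_
  by_cases h : (i : ℕ) < n ∧ (j : ℕ) < n
  · simpa [padMatrix, h] using continuous_id.matrix_elem _ _
  · simpa [padMatrix, h] using continuous_const

instance GLInfZero_normal : (GLInfZero A).Normal where
  conj_mem u hu g := by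
    refine Subgroup.iSup_induction' (C := fun v _ => g * v * g⁻¹ ∈ GLInfZero A) _ ?_ ?_ ?_ hu
    · rintro n _ ⟨a, ⟨p⟩, rfl⟩
      obtain ⟨m, b, rfl⟩ : ∃ (m : ℕ) (b : GL (Fin m) A), glToInf A m b = g := by
        induction g using DirectLimit.induction with
        | _ m b => exact ⟨m, b, rfl⟩
      have hpad : ∀ (i j : ℕ) (h : i ≤ j) (c : GL (Fin i) A),
          glToInf A i c = glToInf A j (glPad A i j h c) := fun i j h c =>
        Quotient.sound ⟨j, h, le_rfl, (DirectedSystem.map_self' (glPad A) _).symm⟩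
      rw [hpad n (max n m) (le_max_left _ _) a, hpad m (max n m) (le_max_right _ _) b,
        ← map_mul, ← map_inv, ← map_mul]
      refine Subgroup.mem_iSup_of_mem (max n m) ⟨_, ?_, rfl⟩
      have hc : Continuous (glPad A n (max n m) (le_max_left _ _)) :=
        Continuous.units_map _ continuous_padMatrix
      exact ⟨(p.map (f := fun c => glPad A m (max n m) (le_max_right _ _) b *
        glPad A n (max n m) (le_max_left _ _) c *
        (glPad A m (max n m) (le_max_right _ _) b)⁻¹) (by fun_prop)).cast (by simp) (by simp)⟩
    · simp
    · intro v w _ _ hv hw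
      have : g * (v * w) * g⁻¹ = (g * v * g⁻¹) * (g * w * g⁻¹) := by group
      rw [this]
      exact mul_mem hv hw

/-- `K_1(A) = GL_∞(A) / GL_∞(A)_0`. -/
abbrev K1 : Type _ := GLInf A ⧸ GLInfZero A

end K1

section K0

variable (A : Type*) [CommRing A]

/-- Algebraic (Murray-von Neumann) equivalence of square matrices `e`, `f` (possibly of different
size): `e = x * y` and `f = y * x` for some rectangular matrices `x`, `y`. -/
def MatEquiv {A : Type*} [CommRing A] {ι κ : Type*} [Fintype ι] [Fintype κ]
    (e : Matrix ι ι A) (f : Matrix κ κ A) : Prop :=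
  ∃ (x : Matrix ι κ A) (y : Matrix κ ι A), x * y = e ∧ y * x = f

section

variable {A} {ι κ μ ν : Type*} [Fintype ι] [Fintype κ] [Fintype μ] [Fintype ν]

theorem MatEquiv.refl {e : Matrix ι ι A} (he : IsIdempotentElem e) : MatEquiv e e :=
  ⟨e, e, he, he⟩

theorem MatEquiv.symm {e : Matrix ι ι A} {f : Matrix κ κ A} (h : MatEquiv e f) :
    MatEquiv f e := by
  obtain ⟨x, y, h1, h2⟩ := h
  exact ⟨y, x, h2, h1⟩

theorem MatEquiv.trans {e : Matrix ι ι A} {f : Matrix κ κ A} {g : Matrix μ μ A}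
    (he : IsIdempotentElem e) (hg : IsIdempotentElem g)
    (h : MatEquiv e f) (h' : MatEquiv f g) : MatEquiv e g := by
  obtain ⟨x, y, rfl, rfl⟩ := h
  obtain ⟨z, w, h1, rfl⟩ := h'
  refine ⟨x * z, w * y, ?_, ?_⟩
  · rw [Matrix.mul_assoc, ← Matrix.mul_assoc z, h1, ← he.eq]
    simp only [Matrix.mul_assoc]
  · rw [Matrix.mul_assoc, ← Matrix.mul_assoc y, ← h1, ← hg.eq]
    simp only [Matrix.mul_assoc]

theorem MatEquiv.reindex {e : Matrix ι ι A} (he : IsIdempotentElem e) (σ : ι ≃ κ) :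
    MatEquiv e (Matrix.reindex σ σ e) := by
  refine ⟨e.submatrix id σ.symm, e.submatrix σ.symm id, ?_, ?_⟩
  · rw [Matrix.submatrix_mul_equiv, he.eq, Matrix.submatrix_id_id]
  · rw [← Matrix.submatrix_mul _ _ _ _ _ Function.bijective_id, he.eq]
    rfl

/-- The block sum of two square matrices. -/
def blockSum (e : Matrix ι ι A) (f : Matrix κ κ A) : Matrix (ι ⊕ κ) (ι ⊕ κ) A :=
  Matrix.fromBlocks e 0 0 f

theorem blockSum_idem {e : Matrix ι ι A} {f : Matrix κ κ A} (he : IsIdempotentElem e)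
    (hf : IsIdempotentElem f) : IsIdempotentElem (blockSum e f) := by
  simp [IsIdempotentElem, blockSum, Matrix.fromBlocks_multiply, he.eq, hf.eq]

theorem MatEquiv.blockSum {e : Matrix ι ι A} {f : Matrix κ κ A} {e' : Matrix μ μ A}
    {f' : Matrix ν ν A} (h : MatEquiv e e') (h' : MatEquiv f f') :
    MatEquiv (blockSum e f) (blockSum e' f') := by
  obtain ⟨x, y, rfl, rfl⟩ := h
  obtain ⟨z, w, rfl, rfl⟩ := h'
  exact ⟨Matrix.fromBlocks x 0 0 z, Matrix.fromBlocks y 0 0 w,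
    by simp [KTheory.blockSum, Matrix.fromBlocks_multiply],
    by simp [KTheory.blockSum, Matrix.fromBlocks_multiply]⟩

theorem reindex_idem {e : Matrix ι ι A} (he : IsIdempotentElem e) (σ : ι ≃ κ) :
    IsIdempotentElem (Matrix.reindex σ σ e) := by
  simp [IsIdempotentElem, Matrix.submatrix_mul_equiv, he.eq]

end

/-- Idempotent matrices of arbitrary finite size over `A`. -/
def IdemMatrix : Type _ := Σ n : ℕ, {e : Matrix (Fin n) (Fin n) A // IsIdempotentElem e}

instance IdemMatrix.setoid : Setoid (IdemMatrix A) where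
  r e f := MatEquiv e.2.1 f.2.1
  iseqv := ⟨fun e => .refl e.2.2, .symm, fun {e _ g} h h' => .trans e.2.2 g.2.2 h h'⟩

variable {A} in
/-- The block sum of idempotent matrices. -/
def IdemMatrix.add (e f : IdemMatrix A) : IdemMatrix A :=
  ⟨e.1 + f.1, Matrix.reindex finSumFinEquiv finSumFinEquiv (blockSum e.2.1 f.2.1),
    reindex_idem (blockSum_idem e.2.2 f.2.2) _⟩

variable {A} in
theorem IdemMatrix.add_equiv (e f : IdemMatrix A) :
    MatEquiv (e.add f).2.1 (blockSum e.2.1 f.2.1) :=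
  (MatEquiv.reindex (blockSum_idem e.2.2 f.2.2) finSumFinEquiv).symm

/-- The semigroup `V(A)` of equivalence classes of idempotent matrices over `A`. -/
def V : Type _ := Quotient (IdemMatrix.setoid A)

instance : Zero (V A) := ⟨Quotient.mk _ ⟨0, 0, by simp [IsIdempotentElem]⟩⟩

instance : Add (V A) where
  add := Quotient.map₂ IdemMatrix.add fun e e' h f f' h' =>
    (MatEquiv.trans (e.add f).2.2 (blockSum_idem e'.2.2 f'.2.2) (e.add_equiv f)
      (h.blockSum h')).trans (e.add f).2.2 (e'.add f').2.2 (e'.add_equiv f').symm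

instance : AddCommMonoid (V A) where
  add_assoc a b c := by
    induction a, b, c using Quotient.inductionOn₃ with
    | _ a b c =>
    refine Quotient.sound (?_ : MatEquiv ((a.add b).add c).2.1 (a.add (b.add c)).2.1)
    have h1 : MatEquiv ((a.add b).add c).2.1 (blockSum (blockSum a.2.1 b.2.1) c.2.1) :=
      .trans ((a.add b).add c).2.2 (blockSum_idem (blockSum_idem a.2.2 b.2.2) c.2.2)
        ((a.add b).add_equiv c) ((a.add_equiv b).blockSum (.refl c.2.2))
    have h2 : MatEquiv (a.add (b.add c)).2.1 (blockSum a.2.1 (blockSum b.2.1 c.2.1)) :=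
      .trans (a.add (b.add c)).2.2 (blockSum_idem a.2.2 (blockSum_idem b.2.2 c.2.2))
        (a.add_equiv (b.add c)) (MatEquiv.blockSum (.refl a.2.2) (b.add_equiv c))
    have h3 : MatEquiv (blockSum (blockSum a.2.1 b.2.1) c.2.1)
        (blockSum a.2.1 (blockSum b.2.1 c.2.1)) := by
      have := MatEquiv.reindex (blockSum_idem (blockSum_idem a.2.2 b.2.2) c.2.2)
        (Equiv.sumAssoc _ _ _)
      convert this using 1
      ext (i | i | i) (j | j | j) <;> simp [blockSum]
    exact (h1.trans ((a.add b).add c).2.2 (blockSum_idem a.2.2 (blockSum_idem b.2.2 c.2.2))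
      h3).trans ((a.add b).add c).2.2 (a.add (b.add c)).2.2 h2.symm
  zero_add a := by
    induction a using Quotient.inductionOn with
    | _ a =>
    refine Quotient.sound (?_ : MatEquiv (IdemMatrix.add ⟨0, 0, _⟩ a).2.1 a.2.1)
    refine .trans (IdemMatrix.add _ a).2.2 a.2.2 (IdemMatrix.add_equiv _ a) ?_
    have := MatEquiv.reindex (blockSum_idem (e := (0 : Matrix (Fin 0) (Fin 0) A))
      (by simp [IsIdempotentElem]) a.2.2) (Equiv.emptySum (Fin 0) (Fin a.1))
    convert this using 1
    ext i j
    simp [blockSum]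
  add_zero a := by
    induction a using Quotient.inductionOn with
    | _ a =>
    refine Quotient.sound (?_ : MatEquiv (IdemMatrix.add a ⟨0, 0, _⟩).2.1 a.2.1)
    refine .trans (IdemMatrix.add a _).2.2 a.2.2 (IdemMatrix.add_equiv a _) ?_
    have := MatEquiv.reindex (blockSum_idem a.2.2 (f := (0 : Matrix (Fin 0) (Fin 0) A))
      (by simp [IsIdempotentElem])) (Equiv.sumEmpty (Fin a.1) (Fin 0))
    convert this using 1
    ext i j
    simp [blockSum]
  add_comm a b := by
    induction a, b using Quotient.inductionOn₂ with
    | _ a b =>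
    refine Quotient.sound (?_ : MatEquiv (a.add b).2.1 (b.add a).2.1)
    have h3 : MatEquiv (blockSum a.2.1 b.2.1) (blockSum b.2.1 a.2.1) := by
      have := MatEquiv.reindex (blockSum_idem a.2.2 b.2.2) (Equiv.sumComm _ _)
      convert this using 1
      ext (i | i) (j | j) <;> simp [blockSum]
    exact ((a.add_equiv b).trans (a.add b).2.2 (blockSum_idem b.2.2 a.2.2) h3).trans
      (a.add b).2.2 (b.add a).2.2 (b.add_equiv a).symm
  nsmul := nsmulRec

/-- `K_0(A)`, the Grothendieck group of `V(A)`. -/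
abbrev K0 : Type _ := Algebra.GrothendieckAddGroup (V A)

end K0

/-- The complex topological K-theory `K^*(X) = K^0(X) ⊕ K^1(X)` of a compact Hausdorff space,
where `K^i(X) = K_i(C(X))`. -/
abbrev KSpace (X : Type*) [TopologicalSpace X] [CompactSpace X] : Type _ :=
  K0 C(X, ℂ) × K1 C(X, ℂ)

end KTheory

/-! ### The Higson `G`-compactification and the Higson `G`-corona -/

namespace HigsonCorona

theorem compactSpace_characterSpace (B : Type*) [NormedRing B] [NormedAlgebra ℂ B]
    [CompleteSpace B] : CompactSpace (WeakDual.characterSpace ℂ B) := inferInstance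

/-- A subset of `M` is cocompact if its image in `M/G` has compact closure. -/
def IsCocompact (G : Type*) {M : Type*} [Group G] [MulAction G M] [TopologicalSpace M]
    (K : Set M) : Prop :=
  IsCompact (closure (Quotient.mk (MulAction.orbitRel G M) '' K))

theorem IsCocompact.union {G M : Type*} [Group G] [MulAction G M] [TopologicalSpace M]
    {K L : Set M} (hK : IsCocompact G K) (hL : IsCocompact G L) : IsCocompact G (K ∪ L) := by
  unfold IsCocompact at *
  rw [Set.image_union, closure_union]
  exact hK.union hL

/-- `φ` tends to zero at infinity transversally to the orbits: for each `ε > 0` one has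
`φ < ε` outside some cocompact set. -/
def VanishesTransversally (G : Type*) {M : Type*} [Group G] [MulAction G M] [TopologicalSpace M]
    (φ : M → ℝ) : Prop :=
  ∀ ε > 0, ∃ K : Set M, IsCocompact G K ∧ ∀ x ∉ K, φ x < ε

section

variable (E : Type*) [NormedAddCommGroup E] [NormedSpace ℝ E]
  {M : Type*} [TopologicalSpace M] [ChartedSpace E M]
  [Bundle.RiemannianBundle (fun x : M => TangentSpace 𝓘(ℝ, E) x)]

/-- The differential of a complex valued function at `x`, as a real linear map `T_x M → ℂ`. -/
def dAt (f : M → ℂ) (x : M) : TangentSpace 𝓘(ℝ, E) x →L[ℝ] ℂ :=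
  mfderiv 𝓘(ℝ, E) 𝓘(ℝ, ℂ) f x

/-- The pointwise norm `‖df‖_{T*M}` with respect to the Riemannian metric. -/
def dNorm (f : M → ℂ) (x : M) : ℝ := ‖dAt E f x‖

theorem dNorm_le {f : M → ℂ} {x : M} {C : ℝ} (hC : 0 ≤ C) (h : ∀ v, ‖dAt E f x v‖ ≤ C * ‖v‖) :
    dNorm E f x ≤ C :=
  ContinuousLinearMap.opNorm_le_bound _ hC h

theorem le_dNorm (f : M → ℂ) (x : M) (v : TangentSpace 𝓘(ℝ, E) x) :
    ‖dAt E f x v‖ ≤ dNorm E f x * ‖v‖ :=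
  ContinuousLinearMap.le_opNorm _ _

theorem dNorm_nonneg (f : M → ℂ) (x : M) : 0 ≤ dNorm E f x :=
  norm_nonneg (dAt E f x)

theorem dNorm_add_le {f g : M → ℂ} (x : M) (hf : MDifferentiableAt 𝓘(ℝ, E) 𝓘(ℝ, ℂ) f x)
    (hg : MDifferentiableAt 𝓘(ℝ, E) 𝓘(ℝ, ℂ) g x) :
    dNorm E (f + g) x ≤ dNorm E f x + dNorm E g x := by
  have h : dAt E (f + g) x = dAt E f x + dAt E g x := mfderiv_add hf hg
  rw [dNorm, h]
  exact norm_add_le (dAt E f x) (dAt E g x)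

theorem dNorm_mul_le {f g : M → ℂ} (x : M) (hf : MDifferentiableAt 𝓘(ℝ, E) 𝓘(ℝ, ℂ) f x)
    (hg : MDifferentiableAt 𝓘(ℝ, E) 𝓘(ℝ, ℂ) g x) :
    dNorm E (f * g) x ≤ ‖f x‖ * dNorm E g x + ‖g x‖ * dNorm E f x := by
  have h : dAt E (f * g) x = f x • dAt E g x + g x • dAt E f x :=
    (hf.hasMFDerivAt.mul hg.hasMFDerivAt).mfderiv
  refine dNorm_le E (add_nonneg (mul_nonneg (norm_nonneg _) (dNorm_nonneg E g x))
    (mul_nonneg (norm_nonneg _) (dNorm_nonneg E f x))) fun v => ?_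
  have h' : dAt E (f * g) x v = f x * dAt E g x v + g x * dAt E f x v := by
    rw [h]
    rfl
  rw [h']
  refine (norm_add_le _ _).trans ?_
  rw [norm_mul, norm_mul, add_mul, mul_assoc, mul_assoc]
  gcongr
  · exact le_dNorm E g x v
  · exact le_dNorm E f x v

theorem dNorm_star {f : M → ℂ} (x : M) (hf : MDifferentiableAt 𝓘(ℝ, E) 𝓘(ℝ, ℂ) f x) :
    dNorm E (fun y => star (f y)) x ≤ dNorm E f x := by
  refine dNorm_le E (dNorm_nonneg E f x) fun v => ?_
  have h : dAt E (fun y => star (f y)) x =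
      (Complex.conjCLE : ℂ →L[ℝ] ℂ).comp (dAt E f x) :=
    (((Complex.conjCLE : ℂ →L[ℝ] ℂ).hasMFDerivAt (x := f x)).comp x hf.hasMFDerivAt).mfderiv
  have h' : ‖dAt E (fun y => star (f y)) x v‖ = ‖dAt E f x v‖ := by
    rw [h]
    simp
  rw [h']
  exact le_dNorm E f x v

theorem dNorm_const (c : ℂ) (x : M) : dNorm E (fun _ : M => c) x = 0 := by
  have h : dAt E (fun _ : M => c) x = 0 := mfderiv_const
  rw [dNorm, h]
  exact norm_zero (E := TangentSpace 𝓘(ℝ, E) x →L[ℝ] ℂ)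

variable (G : Type*) [Group G] [MulAction G M]

theorem VanishesTransversally.of_le_add {φ ψ χ : M → ℝ} {C : ℝ} (hC : 0 < C)
    (hφ : VanishesTransversally G φ) (hψ : VanishesTransversally G ψ)
    (h : ∀ x, χ x ≤ C * (φ x + ψ x)) : VanishesTransversally G χ := by
  intro ε hε
  obtain ⟨K, hK, hK'⟩ := hφ (ε / (2 * C)) (by positivity)
  obtain ⟨L, hL, hL'⟩ := hψ (ε / (2 * C)) (by positivity)
  refine ⟨K ∪ L, hK.union hL, fun x hx => ?_⟩
  have h1 := hK' x (fun h => hx (Or.inl h))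
  have h2 := hL' x (fun h => hx (Or.inr h))
  calc χ x ≤ C * (φ x + ψ x) := h x
    _ < C * (ε / (2 * C) + ε / (2 * C)) := by gcongr
    _ = ε := by field_simp; ring

variable (M)

/-- `C_b^G(M)`, the algebra of bounded continuous `G`-invariant functions `M → ℂ`. -/
def boundedInvariant : StarSubalgebra ℂ (M →ᵇ ℂ) where
  carrier := {f | ∀ (g : G) (x : M), f (g • x) = f x}
  mul_mem' ha hb g x := by simp [ha g x, hb g x]
  add_mem' ha hb g x := by simp [ha g x, hb g x]
  algebraMap_mem' c g x := by simp [BoundedContinuousFunction.algebraMap_apply]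
  star_mem' ha g x := by simp [ha g x]

/-- `C_g^{∞,G}(M)`, the algebra of bounded smooth `G`-invariant functions `f` such that `‖df‖`
tends to zero at infinity transversally to the orbits. -/
def smoothHigson : StarSubalgebra ℂ (M →ᵇ ℂ) where
  carrier := {f | f ∈ boundedInvariant M G ∧ ContMDiff 𝓘(ℝ, E) 𝓘(ℝ, ℂ) ∞ f ∧
    VanishesTransversally G (dNorm E f)}
  mul_mem' := by
    rintro a b ⟨ha, ha', ha''⟩ ⟨hb, hb', hb''⟩
    refine ⟨mul_mem ha hb, contDiff_mul.contMDiff.comp (ha'.prodMk_space hb'), ?_⟩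
    refine VanishesTransversally.of_le_add G (C := ‖a‖ + ‖b‖ + 1) (by positivity) ha'' hb''
      fun x => ?_
    refine (dNorm_mul_le E x (ha'.mdifferentiable (by simp) x)
      (hb'.mdifferentiable (by simp) x)).trans ?_
    have h1 := a.norm_coe_le_norm x
    have h2 := b.norm_coe_le_norm x
    have h3 := dNorm_nonneg E a x
    have h4 := dNorm_nonneg E b x
    have h5 := norm_nonneg a
    have h6 := norm_nonneg b
    nlinarith [mul_le_mul_of_nonneg_right h1 h4, mul_le_mul_of_nonneg_right h2 h3,
      mul_nonneg h5 h3, mul_nonneg h6 h4]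
  add_mem' := by
    rintro a b ⟨ha, ha', ha''⟩ ⟨hb, hb', hb''⟩
    refine ⟨add_mem ha hb, ha'.add hb', ?_⟩
    refine VanishesTransversally.of_le_add G (C := 1) one_pos ha'' hb'' fun x => ?_
    rw [one_mul]
    exact dNorm_add_le E x (ha'.mdifferentiable (by simp) x) (hb'.mdifferentiable (by simp) x)
  algebraMap_mem' c := by
    refine ⟨algebraMap_mem _ c, contMDiff_const, fun ε hε => ⟨∅, by simp [IsCocompact], ?_⟩⟩
    intro x _
    exact (dNorm_const E c x).trans_lt hε
  star_mem' := by
    rintro a ⟨ha, ha', ha''⟩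
    refine ⟨star_mem ha, (Complex.conjCLE : ℂ →L[ℝ] ℂ).contMDiff.comp ha', fun ε hε => ?_⟩
    obtain ⟨K, hK, hK'⟩ := ha'' ε hε
    exact ⟨K, hK, fun x hx =>
      (dNorm_star E x (ha'.mdifferentiable (by simp) x)).trans_lt (hK' x hx)⟩

/-- `C_g^G(M)`, the completion of `C_g^{∞,G}(M)` for the supremum norm. Its maximal ideal space is
the Higson `G`-compactification of `M`. -/
abbrev Cg : Type _ := (smoothHigson E M G).topologicalClosure

/-- The functions in `C_g^G(M)` that tend to zero at infinity transversally to the orbits, as an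
ideal of `C_g^G(M)`. As every continuous `G`-invariant function tending to zero at infinity
transversally to the orbits belongs to `C_g^G(M)`, this is `C_0^G(M)`. -/
def C0 : Ideal (Cg E M G) where
  carrier := {f | VanishesTransversally G fun x => ‖(f : M →ᵇ ℂ) x‖}
  zero_mem' ε hε := ⟨∅, by simp [IsCocompact], fun x _ => by simpa using hε⟩
  add_mem' {a b} ha hb := by
    refine VanishesTransversally.of_le_add G (C := 1) one_pos ha hb fun x => ?_
    rw [one_mul]
    exact norm_add_le ((a : M →ᵇ ℂ) x) ((b : M →ᵇ ℂ) x)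
  smul_mem' c a ha := by
    refine VanishesTransversally.of_le_add G (C := ‖(c : M →ᵇ ℂ)‖ + 1) (by positivity) ha ha
      fun x => ?_
    have h1 := (c : M →ᵇ ℂ).norm_coe_le_norm x
    have h2 : ‖((c • a : Cg E M G) : M →ᵇ ℂ) x‖ = ‖(c : M →ᵇ ℂ) x‖ * ‖(a : M →ᵇ ℂ) x‖ :=
      norm_mul _ _
    rw [h2]
    have h3 := norm_nonneg ((a : M →ᵇ ℂ) x)
    have h4 := norm_nonneg (c : M →ᵇ ℂ)
    nlinarith [mul_le_mul_of_nonneg_right h1 h3, mul_nonneg h4 h3]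

instance C0_isClosed : IsClosed (C0 E M G : Set (Cg E M G)) := by
  refine isClosed_of_closure_subset fun f hf ε hε => ?_
  obtain ⟨h, hh, hd⟩ := Metric.mem_closure_iff.1 hf (ε / 2) (by positivity)
  obtain ⟨K, hK, hK'⟩ := hh (ε / 2) (by positivity)
  refine ⟨K, hK, fun x hx => ?_⟩
  have h1 := hK' x hx
  have h2 : dist ((f : M →ᵇ ℂ) x) ((h : M →ᵇ ℂ) x) ≤ dist f h :=
    BoundedContinuousFunction.dist_coe_le_dist x
  rw [dist_eq_norm] at h2
  have h3 := norm_le_norm_add_norm_sub' ((f : M →ᵇ ℂ) x) ((h : M →ᵇ ℂ) x)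
  have h4 : ‖(h : M →ᵇ ℂ) x‖ < ε / 2 := h1
  change ‖(f : M →ᵇ ℂ) x‖ < ε
  linarith

/-- The algebra `C_g^G(M) / C_0^G(M)`. -/
abbrev CoronaAlgebra : Type _ := Cg E M G ⧸ C0 E M G

/-- The Higson `G`-corona, the maximal ideal space of `C_g^G(M) / C_0^G(M)`. -/
abbrev Corona : Type _ := WeakDual.characterSpace ℂ (CoronaAlgebra E M G)

instance corona_compactSpace : CompactSpace (Corona E M G) :=
  compactSpace_characterSpace (CoronaAlgebra E M G)

end

end HigsonCorona

/-! ### The determinant on `K_1` and logarithms of units -/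

namespace KTheory

section Det

variable {A : Type*} [CommRing A]

/-! The idea is to produce a one-parameter family of units `u t` of `C_g^G(M)` whose `K_1`-classes
are pairwise distinct, even after restriction to the corona. As the parameter is real, every group
in the theorem is then uncountable.

The units come from geometry. Let r be the distance to a fixed orbit. It is invariant, finite
because `M/G` is connected, and 1-Lipschitz. By Hopf–Rinow closed balls of `M` are compact, so
sublevel sets of r are cocompact, and r is unbounded because `M/G` is not compact. Local smoothing
in charts, followed by averaging over `G` with an invariant partition of unity, replaces r by a
smooth invariant f with |f - r| ≤ 1 and gradient at most 5 (`exists_smooth_invariant_near`). Put `u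
t` = exp(i t log(1 + f²)). The logarithm grows so slowly that the differential, of size at most 5|t|
· 2|f|/(1 + f²), tends to 0 transversally, yet log(1 + f²) is still unbounded.

The classes are separated as follows. The determinant turns an equality of classes in `K_1` into a
path of units from 1 to u = (`u s`)⁻¹ `u t`, and in `C(X)` the identity component of the units
consists of exponentials. So if the classes of `u s` and `u t` agree, u restricts to some exp h on
the corona. By Stone–Weierstrass h is nearly the restriction of some a in `C_g^G(M)`, hence u
exp(-a) lies within distance 1 of the value 1 outside a cocompact set (`exists_near_exp`). There the
real function (t - s) log(1 + f²) - Im a avoids all odd multiples of π. Being continuous on the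
connected space `M/G`, it cannot jump over such a value, so it is bounded (`bddAbove_of_cos_ne`).
Since a is bounded while log(1 + f²) is not, s = t. -/

theorem det_padMatrix {n m : ℕ} (h : n ≤ m) (U : Matrix (Fin n) (Fin n) A) :
    (padMatrix A (m := m) U).det = U.det := by
  obtain ⟨k, rfl⟩ := Nat.exists_eq_add_of_le h
  have h1 : (padMatrix A (m := n + k) U).submatrix finSumFinEquiv finSumFinEquiv =
      Matrix.fromBlocks U 0 0 1 := by
    ext (i | i) (j | j)
    · simp [padMatrix]
    · have : (i : ℕ) ≠ n + j := by omega
      simp [padMatrix, Fin.ext_iff, this]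
    · have : n + (i : ℕ) ≠ j := by omega
      simp [padMatrix, Fin.ext_iff, this]
    · simp [padMatrix, Matrix.one_apply, Fin.ext_iff]
  rw [← Matrix.det_submatrix_equiv_self finSumFinEquiv, h1]
  simp

variable (A)

/-- The determinant on `GL_∞`. -/
def detInf : GLInf A →* Aˣ where
  toFun := DirectLimit.lift (glPad A) (fun _ U => Matrix.GeneralLinearGroup.det U)
    fun n m h U => by
      ext
      exact (det_padMatrix h (U : Matrix (Fin n) (Fin n) A)).symm
  map_one' := by
    rw [DirectLimit.one_def 0, DirectLimit.lift_def, map_one]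
  map_mul' x y := by
    refine DirectLimit.induction₂ _ (fun i x y => ?_) x y
    rw [DirectLimit.mul_def, DirectLimit.lift_def, DirectLimit.lift_def, DirectLimit.lift_def,
      map_mul]

/-- The class in `K_1(A)` of a unit of `A`. -/
def unitClass : Aˣ →* GLInf A :=
  (glToInf A 1).comp (Units.map (Matrix.scalar (Fin 1)).toMonoidHom)

theorem detInf_unitClass (u : Aˣ) : detInf A (unitClass A u) = u := by
  change Matrix.GeneralLinearGroup.det _ = u
  ext
  simp [Matrix.GeneralLinearGroup.det]

variable [TopologicalSpace A] [IsTopologicalRing A]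

/-- The determinant is a continuous homomorphism on each `GL_n`, so it carries the generators of
`GLInfZero` into the subgroup of units joined to 1. -/
theorem joined_detInf {x : GLInf A} (hx : x ∈ GLInfZero A) : Joined 1 (detInf A x) := by
  have h : GLInfZero A ≤ (pathComponentOne Aˣ).comap (detInf A) := by
    refine iSup_le fun n => ?_
    rintro _ ⟨U, ⟨p⟩, rfl⟩
    have hc : Continuous (Matrix.GeneralLinearGroup.det : GL (Fin n) A →* Aˣ) :=
      Units.continuous_iff.2 ⟨(Units.continuous_val.matrix_det : Continuous fun U : GL (Fin n) A =>
        (U : Matrix (Fin n) (Fin n) A).det), ((Units.continuous_val.comp continuous_inv).matrix_det :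
          Continuous fun U : GL (Fin n) A => ((U⁻¹ : GL (Fin n) A) : Matrix (Fin n) (Fin n) A).det)⟩
    exact ⟨(p.map hc).cast (by simp) rfl⟩
  exact h hx

/-- Since the determinant is a left inverse of `unitClass`, units with the same class in `K_1`
differ by a factor joined to 1 already in the group of units. -/
theorem joined_of_unitClass_eq {u v : Aˣ}
    (h : (QuotientGroup.mk (unitClass A u) : K1 A) = QuotientGroup.mk (unitClass A v)) :
    Joined 1 (u⁻¹ * v) := by
  have := joined_detInf A (QuotientGroup.eq.1 h)
  rwa [map_mul, map_inv, detInf_unitClass, detInf_unitClass] at this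

end Det

theorem Joined.units_map {A B : Type*} [Monoid A] [Monoid B] [TopologicalSpace A]
    [TopologicalSpace B] (φ : A →* B) (hφ : Continuous φ) {u : Aˣ} (h : Joined 1 u) :
    Joined 1 (Units.map φ u) := by
  obtain ⟨p⟩ := h
  exact ⟨(p.map (Continuous.units_map φ hφ)).cast (by simp) rfl⟩

/-- The units of `C(X, ℂ)` that are exponentials. -/
def expUnits (X : Type*) [TopologicalSpace X] : Subgroup C(X, ℂ)ˣ where
  carrier := {u | ∃ h : C(X, ℂ), ∀ x, (u : C(X, ℂ)) x = Complex.exp (h x)}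
  one_mem' := ⟨0, by simp⟩
  mul_mem' := by
    rintro u v ⟨h, hh⟩ ⟨k, hk⟩
    exact ⟨h + k, fun x => by simp [hh, hk, Complex.exp_add]⟩
  inv_mem' := by
    rintro u ⟨h, hh⟩
    refine ⟨-h, fun x => ?_⟩
    have h1 : ((u⁻¹ : C(X, ℂ)ˣ) : C(X, ℂ)) x * (u : C(X, ℂ)) x = 1 := by
      rw [← ContinuousMap.mul_apply, Units.inv_mul, ContinuousMap.one_apply]
    rw [hh] at h1
    rw [ContinuousMap.neg_apply, Complex.exp_neg]
    exact eq_inv_of_mul_eq_one_left h1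

/-- Units close to 1 take values in the slit plane and have a continuous logarithm, so the
exponentials form an open subgroup. An open subgroup is also closed, and a path starting in it stays
in it. -/
theorem exists_exp_of_joined {X : Type*} [TopologicalSpace X] [CompactSpace X] {u : C(X, ℂ)ˣ}
    (hu : Joined 1 u) : ∃ h : C(X, ℂ), ∀ x, (u : C(X, ℂ)) x = Complex.exp (h x) := by
  have hopen : IsOpen (expUnits X : Set C(X, ℂ)ˣ) := by
    refine Subgroup.isOpen_of_mem_nhds _ (g := 1) ?_
    have h1 : {u : C(X, ℂ)ˣ | dist (u : C(X, ℂ)) 1 < 1} ∈ nhds (1 : C(X, ℂ)ˣ) :=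
      (isOpen_lt (by fun_prop) continuous_const).mem_nhds (by simp)
    refine Filter.mem_of_superset h1 fun v hv => ?_
    have hslit : ∀ x, (v : C(X, ℂ)) x ∈ Complex.slitPlane := fun x => by
      have h2 := (ContinuousMap.dist_apply_le_dist (f := (v : C(X, ℂ))) (g := 1) x).trans_lt hv
      rw [dist_eq_norm, ContinuousMap.one_apply] at h2
      have h3 := (Complex.abs_re_le_norm _).trans_lt h2
      rw [Complex.sub_re, Complex.one_re, abs_lt] at h3
      exact Or.inl (by linarith [h3.1])
    refine ⟨⟨fun x => Complex.log ((v : C(X, ℂ)) x),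
      (v : C(X, ℂ)).continuous.clog hslit⟩, fun x => ?_⟩
    exact (Complex.exp_log (Complex.slitPlane_ne_zero (hslit x))).symm
  have hclopen : IsClopen (expUnits X : Set C(X, ℂ)ˣ) :=
    ⟨Subgroup.isClosed_of_isOpen _ hopen, hopen⟩
  obtain ⟨p⟩ := hu
  have h1 : IsPreconnected (Set.range p) := isPreconnected_range p.continuous
  have h2 := h1.subset_isClopen hclopen ⟨1, ⟨0, p.source⟩, one_mem _⟩
  exact h2 ⟨1, p.target⟩

end KTheory

/-! ### Reduction to the existence of an unbounded function -/

theorem continuous_gelfandTransform (A : Type*) [NormedCommRing A] [NormedAlgebra ℂ A]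
    [CompleteSpace A] : Continuous (WeakDual.gelfandTransform ℂ A) := by
  refine AddMonoidHomClass.continuous_of_bound _ ‖(1 : A)‖ fun a => ?_
  rw [ContinuousMap.norm_le _ (by positivity)]
  intro φ
  refine ((WeakDual.toStrongDual (φ : WeakDual ℂ A)).le_opNorm a).trans ?_
  gcongr
  exact WeakDual.CharacterSpace.norm_le_norm_one φ

/-- The spectrum of a is the set of its character values, so its spectral radius is at most r, and
Gelfand's formula bounds large powers. Only powers are controlled because the norm of A is not
assumed to be the spectral norm. -/
theorem exists_norm_pow_lt_of_forall_character {A : Type*} [NormedCommRing A] [NormedAlgebra ℂ A]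
    [CompleteSpace A] {a : A} {r s : ℝ} (hr : 0 ≤ r) (hrs : r < s)
    (h : ∀ φ : WeakDual.characterSpace ℂ A, ‖φ a‖ ≤ r) : ∃ n : ℕ, n ≠ 0 ∧ ‖a ^ n‖ < s ^ n := by
  have h1 : spectralRadius ℂ a ≤ ENNReal.ofReal r := by
    refine iSup₂_le fun k hk => ?_
    obtain ⟨φ, hφ⟩ := WeakDual.CharacterSpace.mem_spectrum_iff_exists.1 hk
    have h2 := h φ
    rw [hφ] at h2
    rw [← enorm_eq_nnnorm, ← ofReal_norm]
    exact ENNReal.ofReal_le_ofReal h2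
  have h2 : spectralRadius ℂ a < ENNReal.ofReal s :=
    h1.trans_lt ((ENNReal.ofReal_lt_ofReal_iff (hr.trans_lt hrs)).2 hrs)
  have h3 := spectrum.pow_nnnorm_pow_one_div_tendsto_nhds_spectralRadius a
  obtain ⟨n, hn, hn0⟩ := ((h3.eventually (gt_mem_nhds h2)).and
    (Filter.eventually_ne_atTop 0)).exists
  refine ⟨n, hn0, ?_⟩
  have hn' : (0 : ℝ) < n := by positivity
  have h4 := ENNReal.rpow_lt_rpow hn hn'
  rw [← ENNReal.rpow_mul, one_div_mul_cancel hn'.ne', ENNReal.rpow_one, ENNReal.rpow_natCast,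
    ← ENNReal.ofReal_pow (hr.trans hrs.le), ← enorm_eq_nnnorm, ← ofReal_norm,
    ENNReal.ofReal_lt_ofReal_iff (by have := hr.trans_lt hrs; positivity)] at h4
  exact h4

/-! ### From functions on the corona to functions near infinity -/

namespace HigsonCorona

section

variable (E : Type*) [NormedAddCommGroup E] [NormedSpace ℝ E]
  (M : Type*) [TopologicalSpace M] [ChartedSpace E M]
  [Bundle.RiemannianBundle (fun x : M => TangentSpace 𝓘(ℝ, E) x)]
  (G : Type*) [Group G] [MulAction G M]

/-- Pulled back to the C*-algebra `Cg`, a character of the quotient is automatically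
star-preserving. Thus no C*-structure on the quotient itself is needed. -/
theorem character_mk_star (φ : Corona E M G) (a : Cg E M G) :
    φ (Ideal.Quotient.mk (C0 E M G) (star a)) =
      star (φ (Ideal.Quotient.mk (C0 E M G) a)) := by
  let : CStarAlgebra (Cg E M G) := { }
  exact map_star ((WeakDual.CharacterSpace.toAlgHom φ).comp
    (Ideal.Quotient.mkₐ ℂ (C0 E M G))) a

/-- The restriction of functions to the corona. -/
def toCorona : Cg E M G →⋆ₐ[ℂ] C(Corona E M G, ℂ) where
  __ := (WeakDual.gelfandTransform ℂ (CoronaAlgebra E M G)).comp (Ideal.Quotient.mkₐ ℂ (C0 E M G))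
  map_star' a := by
    ext φ
    exact character_mk_star E M G φ a

theorem continuous_mk_C0 : Continuous (Ideal.Quotient.mk (C0 E M G)) :=
  continuous_quotient_mk'

/-- Stone–Weierstrass: restrictions from `Cg` form a star subalgebra, and they separate points
because a character of the quotient is determined by its values on classes of elements of `Cg`. -/
theorem exists_toCorona_near (h : C(Corona E M G, ℂ)) {ε : ℝ} (hε : 0 < ε) :
    ∃ a : Cg E M G, ‖toCorona E M G a - h‖ < ε := by
  have h1 := ContinuousMap.starSubalgebra_topologicalClosure_eq_top_of_separatesPoints
    (toCorona E M G).range (by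
      intro φ ψ hne
      by_contra! hcon
      refine hne (DFunLike.ext _ _ fun b => ?_)
      obtain ⟨a, rfl⟩ := Ideal.Quotient.mk_surjective b
      exact hcon _ ⟨_, ⟨a, rfl⟩, rfl⟩)
  have h2 : h ∈ (toCorona E M G).range.topologicalClosure := by rw [h1]; trivial
  obtain ⟨_, ⟨a, rfl⟩, ha⟩ := Metric.mem_closure_iff.1 h2 ε hε
  refine ⟨a, ?_⟩
  rwa [dist_comm, dist_eq_norm] at ha

/-- Some power of the class of c has quotient norm below sⁿ, hence a representative d of sup norm
below sⁿ. As d - cⁿ tends to 0 transversally, |c|ⁿ < sⁿ outside a cocompact set. -/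
theorem eventually_lt_of_forall_character {c : Cg E M G} {r s : ℝ} (hr : 0 ≤ r) (hrs : r < s)
    (h : ∀ φ : Corona E M G, ‖toCorona E M G c φ‖ ≤ r) :
    ∃ K : Set M, IsCocompact G K ∧ ∀ x ∉ K, ‖(c : M →ᵇ ℂ) x‖ < s := by
  obtain ⟨n, hn, hlt⟩ := exists_norm_pow_lt_of_forall_character
    (a := Ideal.Quotient.mk (C0 E M G) c) hr hrs h
  obtain ⟨d, hd, hd'⟩ := Ideal.Quotient.norm_mk_lt (I := C0 E M G)
    (Ideal.Quotient.mk (C0 E M G) c ^ n) (sub_pos.2 hlt)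
  rw [add_sub_cancel] at hd'
  rw [← map_pow, Ideal.Quotient.eq] at hd
  obtain ⟨K, hK, hK'⟩ := hd (s ^ n - ‖d‖) (sub_pos.2 hd')
  refine ⟨K, hK, fun x hx => ?_⟩
  have h1 : ‖(d : M →ᵇ ℂ) x - (c : M →ᵇ ℂ) x ^ n‖ < s ^ n - ‖d‖ := hK' x hx
  have h2 : ‖(d : M →ᵇ ℂ) x‖ ≤ ‖d‖ := (d : M →ᵇ ℂ).norm_coe_le_norm x
  have h3 := norm_sub_norm_le ((c : M →ᵇ ℂ) x ^ n) ((d : M →ᵇ ℂ) x)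
  rw [norm_sub_rev] at h3
  rw [norm_pow] at h3
  exact lt_of_pow_lt_pow_left₀ n (hr.trans hrs.le) (by linarith)

variable {E M G} in
theorem coe_exp_apply (a : Cg E M G) (x : M) :
    ((NormedSpace.exp a : Cg E M G) : M →ᵇ ℂ) x = Complex.exp ((a : M →ᵇ ℂ) x) := by
  let ev : Cg E M G →+* ℂ :=
    { toFun := fun b => (b : M →ᵇ ℂ) x
      map_one' := rfl
      map_mul' := fun _ _ => rfl
      map_zero' := rfl
      map_add' := fun _ _ => rfl }
  have hev : Continuous ev :=
    (BoundedContinuousFunction.evalCLM ℂ x).continuous.comp continuous_subtype_val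
  let : NormedAlgebra ℚ (Cg E M G) := NormedAlgebra.restrictScalars ℚ ℂ _
  have := NormedSpace.map_exp ev hev a
  rw [← Complex.exp_eq_exp_ℂ] at this
  exact this

theorem toCorona_exp (a : Cg E M G) (φ : Corona E M G) :
    toCorona E M G (NormedSpace.exp a) φ = Complex.exp (toCorona E M G a φ) := by
  let ev : Cg E M G →+* ℂ :=
    ((WeakDual.CharacterSpace.toAlgHom φ).comp (Ideal.Quotient.mkₐ ℂ (C0 E M G))).toRingHom
  have hev : Continuous ev :=
    (WeakDual.CharacterSpace.toCLM φ).continuous.comp (continuous_mk_C0 E M G)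
  let : NormedAlgebra ℚ (Cg E M G) := NormedAlgebra.restrictScalars ℚ ℂ _
  have := NormedSpace.map_exp ev hev a
  rw [← Complex.exp_eq_exp_ℂ] at this
  exact this

/-- A unit whose restriction to the corona is an exponential is nearly an exponential outside of
a cocompact set. -/
theorem exists_near_exp {u : Cg E M G} {h : C(Corona E M G, ℂ)}
    (hu : ∀ φ, toCorona E M G u φ = Complex.exp (h φ)) :
    ∃ (a : Cg E M G) (K : Set M), IsCocompact G K ∧
      ∀ x ∉ K, ‖(u : M →ᵇ ℂ) x * Complex.exp (-(a : M →ᵇ ℂ) x) - 1‖ < 1 := by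
  -- An error of 1/4 in the exponent gives at most 2 · 1/4 = 1/2 after exponentiation, which leaves
  -- room below 1.
  obtain ⟨a, ha⟩ := exists_toCorona_near E M G h (ε := 1 / 4) (by norm_num)
  obtain ⟨K, hK, hK'⟩ := eventually_lt_of_forall_character E M G
    (c := u * NormedSpace.exp (-a) - 1) (r := 1 / 2) (s := 1) (by norm_num) (by norm_num)
    fun φ => by
      have h1 : ‖h φ - toCorona E M G a φ‖ ≤ 1 / 4 := by
        rw [norm_sub_rev]
        exact ((toCorona E M G a - h).norm_coe_le_norm φ).trans ha.le
      have h2 : toCorona E M G (u * NormedSpace.exp (-a) - 1) φ =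
          Complex.exp (h φ - toCorona E M G a φ) - 1 := by
        rw [map_sub, map_mul, map_one, ContinuousMap.sub_apply, ContinuousMap.mul_apply,
          toCorona_exp, hu, map_neg, ContinuousMap.neg_apply, ContinuousMap.one_apply,
          ← Complex.exp_add, sub_eq_add_neg (h φ)]
      rw [h2]
      refine (Complex.norm_exp_sub_one_le (h1.trans (by norm_num))).trans (by linarith)
  refine ⟨a, K, hK, fun x hx => ?_⟩
  have h1 := hK' x hx
  have h2 := coe_exp_apply (-a) x
  have h3 : ((u * NormedSpace.exp (-a) - 1 : Cg E M G) : M →ᵇ ℂ) x =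
    (u : M →ᵇ ℂ) x * ((NormedSpace.exp (-a) : Cg E M G) : M →ᵇ ℂ) x - 1 := rfl
  rw [h3, h2] at h1
  exact h1

end

/-- A continuous invariant function whose values avoid the odd multiples of `π` outside of a
cocompact set is bounded. -/
theorem bddAbove_of_cos_ne {G M : Type*} [Group G] [MulAction G M] [TopologicalSpace M]
    [ConnectedSpace (MulAction.orbitRel.Quotient G M)] {g : M → ℝ} (hg : Continuous g)
    (hinv : ∀ (a : G) x, g (a • x) = g x) {K : Set M} (hK : IsCocompact G K)
    (h : ∀ x ∉ K, Real.cos (g x) ≠ -1) : ∃ C, ∀ x, |g x| ≤ C := by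
  let q : MulAction.orbitRel.Quotient G M → ℝ :=
    Quotient.lift g fun x y hxy => by
      obtain ⟨a, rfl⟩ := hxy
      exact hinv a y
  have hq : Continuous q := hg.quotient_lift _
  obtain ⟨x₀⟩ : Nonempty (MulAction.orbitRel.Quotient G M) := inferInstance
  obtain ⟨B, hB⟩ := IsCompact.exists_bound_of_continuousOn hK hq.continuousOn
  have hB' : ∀ x ∈ K, |g x| ≤ B := fun x hx => hB _ (subset_closure ⟨x, hx, rfl⟩)
  obtain ⟨n, hn⟩ := exists_nat_gt (max B |q x₀|)
  have hπ := Real.pi_gt_three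
  have hn0 : (0 : ℝ) ≤ n := n.cast_nonneg
  -- L is an odd multiple of π exceeding the bound on K and the value at one base point. Thus |g|
  -- never equals L, inside K or outside, and by the intermediate value theorem on `M/G` it stays
  -- below L.
  set L : ℝ := n * (2 * Real.pi) + Real.pi with hL
  have hLn : max B |q x₀| < L := by nlinarith
  have hcos : Real.cos L = -1 := by
    rw [hL, add_comm, Real.cos_add_nat_mul_two_pi, Real.cos_pi]
  have hne : ∀ x, |g x| ≠ L := fun x hx => by
    by_cases hxK : x ∈ K
    · have := hB' x hxK
      have := le_max_left B |q x₀|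
      linarith
    · refine h x hxK ?_
      rw [← Real.cos_abs, hx, hcos]
  have hrange := isPreconnected_range (f := fun x => |q x|) (by fun_prop)
  refine ⟨L, fun x => ?_⟩
  by_contra! hlt
  obtain ⟨y, hy⟩ := hrange.Icc_subset ⟨x₀, rfl⟩ ⟨Quotient.mk _ x, rfl⟩
    (⟨((le_max_right B _).trans hLn.le), hlt.le⟩ : L ∈ Set.Icc |q x₀| |g x|)
  induction y using Quotient.inductionOn with
  | _ y => exact hne y hy

section

variable (E : Type*) [NormedAddCommGroup E] [NormedSpace ℝ E]
  (M : Type*) [TopologicalSpace M] [ChartedSpace E M]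
  [Bundle.RiemannianBundle (fun x : M => TangentSpace 𝓘(ℝ, E) x)]
  (G : Type*) [Group G] [MulAction G M]

/-- An unbounded invariant function all of whose unitary characters are Higson functions makes the
`K_1`-groups uncountable. -/
theorem uncountable_K1_of_unbounded [ConnectedSpace (MulAction.orbitRel.Quotient G M)]
    {f : M → ℝ} (hf : Continuous f) (hinv : ∀ (a : G) x, f (a • x) = f x)
    (hunb : ∀ C, ∃ x, C < |f x|) (u : ℝ → (Cg E M G)ˣ)
    (hu : ∀ t x, ((u t : Cg E M G) : M →ᵇ ℂ) x = Complex.exp ((t * f x : ℝ) * Complex.I)) :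
    Uncountable (KTheory.KSpace (Corona E M G)) ∧
      Uncountable (KTheory.K1 (CoronaAlgebra E M G)) ∧ Uncountable (KTheory.K1 (Cg E M G)) := by
  let ρ : CoronaAlgebra E M G →* C(Corona E M G, ℂ) :=
    (WeakDual.gelfandTransform ℂ (CoronaAlgebra E M G) : _ →* _)
  have hρ : Continuous ρ := continuous_gelfandTransform (CoronaAlgebra E M G)
  let res : Cg E M G →* CoronaAlgebra E M G := (Ideal.Quotient.mk (C0 E M G) : _ →* _)
  have hres : Continuous res := continuous_mk_C0 E M G
  -- All three groups are handled on the corona: the algebra maps `res` and `ρ` are continuous, so a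
  -- path of units in `Cg` or in the quotient is carried to one in the continuous functions on the
  -- corona.
  have key : ∀ s t, Joined 1 (Units.map ρ (Units.map res ((u s)⁻¹ * u t))) → s = t := by
    intro s t hj
    by_contra hne
    obtain ⟨h, hh⟩ := KTheory.exists_exp_of_joined hj
    obtain ⟨a, K, hK, haK⟩ := exists_near_exp E M G (u := ((u s)⁻¹ * u t : (Cg E M G)ˣ))
      (h := h) hh
    have hval : ∀ x, ((((u s)⁻¹ * u t : (Cg E M G)ˣ) : Cg E M G) : M →ᵇ ℂ) x =
        Complex.exp (((t - s) * f x : ℝ) * Complex.I) := by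
      intro x
      have h1 : ((u s : Cg E M G) : M →ᵇ ℂ) x *
          ((((u s)⁻¹ * u t : (Cg E M G)ˣ) : Cg E M G) : M →ᵇ ℂ) x =
          ((u t : Cg E M G) : M →ᵇ ℂ) x := by
        have : (u s : Cg E M G) * ((u s)⁻¹ * u t : (Cg E M G)ˣ) = u t := by
          rw [← Units.val_mul, mul_inv_cancel_left]
        exact congrArg (fun b : Cg E M G => (b : M →ᵇ ℂ) x) this
      rw [hu, hu] at h1
      refine mul_left_cancel₀ (Complex.exp_ne_zero _) (h1.trans ?_)
      rw [← Complex.exp_add]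
      congr 1
      push_cast
      ring
    obtain ⟨C, hC⟩ := bddAbove_of_cos_ne (G := G)
      (g := fun x => (t - s) * f x - ((a : M →ᵇ ℂ) x).im)
      (by have := (a : M →ᵇ ℂ).continuous; fun_prop)
      (fun g x => by
        have h1 : (a : M →ᵇ ℂ) (g • x) = (a : M →ᵇ ℂ) x := by
          have h2 : (a : M →ᵇ ℂ) ∈ closure (smoothHigson E M G : Set (M →ᵇ ℂ)) := a.2
          refine closure_minimal (t := {b : M →ᵇ ℂ | b (g • x) = b x}) (fun b hb => hb.1 g x)
            (isClosed_eq (BoundedContinuousFunction.evalCLM ℂ (g • x)).continuous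
              (BoundedContinuousFunction.evalCLM ℂ x).continuous) h2
        simp only [hinv, h1])
      -- If the cosine were -1, the number u exp(-a) would have negative real part and so would lie
      -- at distance more than 1 from 1.
      hK (fun x hx hcos => by
        have h1 := haK x hx
        rw [hval, ← Complex.exp_add] at h1
        have h2 := (Complex.abs_re_le_norm _).trans_lt h1
        rw [Complex.sub_re, Complex.exp_re, Complex.one_re, abs_lt] at h2
        have h3 : ((((t - s) * f x : ℝ) : ℂ) * Complex.I + -(a : M →ᵇ ℂ) x).im =
          (t - s) * f x - ((a : M →ᵇ ℂ) x).im := by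
          simp [sub_eq_add_neg]
        rw [h3, hcos] at h2
        have := Real.exp_pos ((((t - s) * f x : ℝ) : ℂ) * Complex.I + -(a : M →ᵇ ℂ) x).re
        linarith [h2.1])
    have hpos : 0 < |t - s| := abs_pos.2 (sub_ne_zero.2 (Ne.symm hne))
    obtain ⟨x, hx⟩ := hunb ((C + ‖(a : M →ᵇ ℂ)‖) / |t - s|)
    rw [div_lt_iff₀ hpos, mul_comm, ← abs_mul] at hx
    have h1 := hC x
    have h2 := (Complex.abs_im_le_norm _).trans ((a : M →ᵇ ℂ).norm_coe_le_norm x)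
    have h3 := abs_sub_abs_le_abs_sub ((t - s) * f x) ((a : M →ᵇ ℂ) x).im
    linarith
  refine ⟨?_, ?_, ?_⟩
  · have : Function.Injective fun t => (QuotientGroup.mk (KTheory.unitClass _
        (Units.map ρ (Units.map res (u t)))) : KTheory.K1 C(Corona E M G, ℂ)) := fun s t hst => by
      refine key s t ?_
      simpa only [map_mul, map_inv] using KTheory.joined_of_unitClass_eq _ hst
    have := this.uncountable
    exact (Prod.snd_surjective : Function.Surjective
      (Prod.snd : KTheory.KSpace (Corona E M G) → _)).uncountable
  · have : Function.Injective fun t => (QuotientGroup.mk (KTheory.unitClass _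
        (Units.map res (u t))) : KTheory.K1 (CoronaAlgebra E M G)) := fun s t hst => by
      refine key s t (KTheory.Joined.units_map ρ hρ ?_)
      simpa only [map_mul, map_inv] using KTheory.joined_of_unitClass_eq _ hst
    exact this.uncountable
  · have : Function.Injective fun t => (QuotientGroup.mk (KTheory.unitClass _ (u t)) :
        KTheory.K1 (Cg E M G)) := fun s t hst =>
      key s t (KTheory.Joined.units_map ρ hρ (KTheory.Joined.units_map res hres
        (KTheory.joined_of_unitClass_eq _ hst)))
    exact this.uncountable

end

end HigsonCorona

/-! ### The Hopf–Rinow theorem for length spaces -/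

/-- An extended metric is a length metric if points can be interpolated approximately. -/
def IsLengthMetric (X : Type*) [PseudoEMetricSpace X] : Prop :=
  ∀ (x y : X) (a b : ENNReal), 0 < a → 0 < b → edist x y < a + b →
    ∃ z, edist x z < a ∧ edist z y < b

namespace IsLengthMetric

variable {X : Type*} [EMetricSpace X]

/-- By local compactness some thickening of the compact ball lies in a compact set. In a length
space a slightly larger ball lies in that thickening. -/
theorem exists_isCompact_closedEBall_gt (hX : IsLengthMetric X) [LocallyCompactSpace X]
    {x : X} {ρ : ℝ} (hρ : 0 < ρ)
    (h : IsCompact (Metric.closedEBall x (ENNReal.ofReal ρ))) :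
    ∃ ρ' > ρ, IsCompact (Metric.closedEBall x (ENNReal.ofReal ρ')) := by
  obtain ⟨K, hK, hsub⟩ := exists_compact_superset h
  obtain ⟨δ, hδ, hδK⟩ := h.exists_thickening_subset_open isOpen_interior hsub
  refine ⟨ρ + δ / 2, by linarith, hK.of_isClosed_subset Metric.isClosed_closedEBall fun y hy => ?_⟩
  refine interior_subset (hδK ?_)
  rw [Metric.mem_thickening_iff_exists_edist_lt]
  have h1 : edist x y < ENNReal.ofReal ρ + ENNReal.ofReal δ := by
    rw [← ENNReal.ofReal_add hρ.le hδ.le, edist_comm]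
    exact (Metric.mem_closedEBall.1 hy).trans_lt
      ((ENNReal.ofReal_lt_ofReal_iff (by positivity)).2 (by linarith))
  obtain ⟨z, hz, hz'⟩ := hX x y _ _ (ENNReal.ofReal_pos.2 hρ) (ENNReal.ofReal_pos.2 hδ) h1
  exact ⟨z, by rw [Metric.mem_closedEBall, edist_comm]; exact hz.le, by rwa [edist_comm]⟩

/-- By completeness only total boundedness is at stake. Every point of the ball is within δ of a
slightly smaller, compact ball, so a finite δ-net of the latter is a finite 2δ-net of the former. -/
theorem isCompact_closedEBall_of_lt (hX : IsLengthMetric X) [CompleteSpace X]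
    {x : X} {ρ : ℝ} (hρ : 0 < ρ)
    (h : ∀ ρ', 0 < ρ' → ρ' < ρ → IsCompact (Metric.closedEBall x (ENNReal.ofReal ρ'))) :
    IsCompact (Metric.closedEBall x (ENNReal.ofReal ρ)) := by
  refine isCompact_iff_totallyBounded_isComplete.2 ⟨?_, Metric.isClosed_closedEBall.isComplete⟩
  refine EMetric.totallyBounded_iff.2 fun ε hε => ?_
  obtain ⟨δ, hδ, hδε⟩ : ∃ δ : ℝ, 0 < δ ∧ ENNReal.ofReal δ + ENNReal.ofReal δ ≤ ε := by
    obtain ⟨δ, hδ, hlt⟩ := ENNReal.lt_iff_exists_nnreal_btwn.1 hε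
    refine ⟨δ / 2, by have : 0 < δ := by exact_mod_cast hδ
                      positivity, ?_⟩
    rw [← ENNReal.ofReal_add (by positivity) (by positivity), add_halves, ENNReal.ofReal_coe_nnreal]
    exact hlt.le
  -- η < δ makes ρ smaller than (ρ - η) + δ, as interpolation requires; η ≤ ρ/2 keeps the smaller
  -- radius positive.
  set η := min (δ / 2) (ρ / 2)
  have hη : 0 < η := lt_min (by positivity) (by positivity)
  have hηρ : η ≤ ρ / 2 := min_le_right _ _
  have hηδ : η ≤ δ / 2 := min_le_left _ _
  obtain ⟨t, ht, htc⟩ := EMetric.totallyBounded_iff.1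
    (h (ρ - η) (by linarith) (by linarith)).totallyBounded (ENNReal.ofReal δ)
      (ENNReal.ofReal_pos.2 hδ)
  refine ⟨t, ht, fun y hy => ?_⟩
  have h1 : edist x y < ENNReal.ofReal (ρ - η) + ENNReal.ofReal δ := by
    rw [← ENNReal.ofReal_add (by linarith) hδ.le, edist_comm]
    exact (Metric.mem_closedEBall.1 hy).trans_lt
      ((ENNReal.ofReal_lt_ofReal_iff (by linarith)).2 (by linarith))
  obtain ⟨z, hz, hz'⟩ := hX x y _ _ (ENNReal.ofReal_pos.2 (by linarith))
    (ENNReal.ofReal_pos.2 hδ) h1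
  obtain ⟨w, hw, hzw⟩ := Set.mem_iUnion₂.1 (htc (show z ∈ Metric.closedEBall x _ by
    rw [Metric.mem_closedEBall, edist_comm]; exact hz.le))
  refine Set.mem_iUnion₂.2 ⟨w, hw, ?_⟩
  rw [Metric.mem_eball] at hzw ⊢
  refine lt_of_lt_of_le ((edist_triangle y z w).trans_lt ?_) hδε
  rw [edist_comm y z]
  exact ENNReal.add_lt_add hz' hzw

/-- The Hopf–Rinow theorem. -/
theorem isCompact_closedEBall (hX : IsLengthMetric X) [LocallyCompactSpace X] [CompleteSpace X]
    (x : X) (ρ : ℝ) :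
    IsCompact (Metric.closedEBall x (ENNReal.ofReal ρ)) := by
  let S : Set ℝ := {s | 0 < s ∧ IsCompact (Metric.closedEBall x (ENNReal.ofReal s))}
  have hdown : ∀ s ∈ S, ∀ s' ≤ s, IsCompact (Metric.closedEBall x (ENNReal.ofReal s')) :=
    fun s hs s' hle => hs.2.of_isClosed_subset Metric.isClosed_closedEBall
      (Metric.closedEBall_subset_closedEBall (ENNReal.ofReal_le_ofReal hle))
  have hne : S.Nonempty := by
    obtain ⟨K, hK, hxK⟩ := exists_compact_mem_nhds x
    obtain ⟨δ, hδ, hδK⟩ := Metric.nhds_basis_closedEBall.mem_iff.1 hxK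
    obtain ⟨s, hs, hlt⟩ := ENNReal.lt_iff_exists_nnreal_btwn.1 hδ
    refine ⟨s, by exact_mod_cast hs, hK.of_isClosed_subset Metric.isClosed_closedEBall
      ((Metric.closedEBall_subset_closedEBall ?_).trans hδK)⟩
    rw [ENNReal.ofReal_coe_nnreal]
    exact hlt.le
  -- If radius ρ failed, the good radii would have a finite supremum. It would itself be good by the
  -- limit lemma, and then exceeded by the enlargement lemma.
  by_contra hnot
  have hbdd : BddAbove S := ⟨ρ, fun s hs => by
    by_contra! hlt
    exact hnot (hdown s hs ρ hlt.le)⟩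
  obtain ⟨s, hs⟩ := hne
  have hpos : 0 < sSup S := hs.1.trans_le (le_csSup hbdd hs)
  have hsup : IsCompact (Metric.closedEBall x (ENNReal.ofReal (sSup S))) := by
    refine hX.isCompact_closedEBall_of_lt hpos fun s' _ hs' => ?_
    obtain ⟨s'', hs'', hlt⟩ := exists_lt_of_lt_csSup ⟨s, hs⟩ hs'
    exact hdown s'' hs'' s' hlt.le
  obtain ⟨s', hs', hc⟩ := hX.exists_isCompact_closedEBall_gt hpos hsup
  exact absurd (le_csSup hbdd (⟨hpos.trans hs', hc⟩ : s' ∈ S)) (not_le.2 hs')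

end IsLengthMetric

/-! ### Curve lengths on Riemannian manifolds -/

section Riemannian

/-- Take a curve from x to y of length below a + b. The times at distance < a from x and those at
distance < b from y form open sets that cover the interval, since an uncovered time would force
length at least a + b. Each contains an endpoint, so by connectedness they meet. -/
theorem IsRiemannianManifold.isLengthMetric (E : Type*) [NormedAddCommGroup E] [NormedSpace ℝ E]
    (M : Type*) [EMetricSpace M] [ChartedSpace E M]
    [Bundle.RiemannianBundle (fun x : M => TangentSpace 𝓘(ℝ, E) x)]
    [IsRiemannianManifold 𝓘(ℝ, E) M] : IsLengthMetric M := by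
  intro x y a b ha hb hab
  rw [IsRiemannianManifold.out (I := 𝓘(ℝ, E)) x y] at hab
  obtain ⟨γ, h0, h1, hγ, hlen⟩ := Manifold.exists_lt_of_riemannianEDist_lt hab
  have hcont : ContinuousOn γ (Set.Icc 0 1) := hγ.continuousOn
  have hcover : Set.Icc (0 : ℝ) 1 ⊆
      (fun t => edist x (γ (Set.projIcc 0 1 zero_le_one t))) ⁻¹' Set.Iio a ∪
      (fun t => edist (γ (Set.projIcc 0 1 zero_le_one t)) y) ⁻¹' Set.Iio b := by
    intro t ht
    by_contra hcon
    simp only [Set.projIcc_of_mem zero_le_one ht, Set.mem_union, Set.mem_preimage, Set.mem_Iio,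
      not_or, not_lt] at hcon
    have h2 := Manifold.riemannianEDist_le_pathELength (I := 𝓘(ℝ, E))
      (hγ.mono (Set.Icc_subset_Icc_right ht.2)) h0 rfl ht.1
    have h3 := Manifold.riemannianEDist_le_pathELength (I := 𝓘(ℝ, E))
      (hγ.mono (Set.Icc_subset_Icc_left ht.1)) rfl h1 ht.2
    rw [← IsRiemannianManifold.out] at h2 h3
    have h4 := Manifold.pathELength_add (I := 𝓘(ℝ, E)) (γ := γ) ht.1 ht.2
    have h5 := add_le_add (hcon.1.trans h2) (hcon.2.trans h3)
    rw [h4] at h5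
    exact absurd hlen (not_lt.2 h5)
  have hcont' : Continuous fun t : ℝ => γ (Set.projIcc 0 1 zero_le_one t) :=
    (continuousOn_iff_continuous_domRestrict.1 hcont).comp continuous_projIcc
  obtain ⟨t, -, hta, htb⟩ := isPreconnected_Icc (a := (0 : ℝ)) (b := 1) _ _
    (isOpen_Iio.preimage (continuous_const.edist hcont'))
    (isOpen_Iio.preimage (hcont'.edist continuous_const)) hcover
    ⟨0, by simp, by simpa [h0] using ha⟩ ⟨1, by simp, by simpa [h1] using hb⟩
  exact ⟨_, hta, htb⟩

variable {E : Type*} [NormedAddCommGroup E] [NormedSpace ℝ E]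
  {M : Type*} [EMetricSpace M] [ChartedSpace E M]
  [Bundle.RiemannianBundle (fun x : M => TangentSpace 𝓘(ℝ, E) x)]
  [IsRiemannianManifold 𝓘(ℝ, E) M]

/-- F preserves the length of every curve, and the distance is the infimum of lengths. -/
theorem edist_le_of_norm_mfderiv_eq [IsManifold 𝓘(ℝ, E) 1 M] {F : M → M}
    (hF : ContMDiff 𝓘(ℝ, E) 𝓘(ℝ, E) 1 F)
    (hnorm : ∀ (x : M) (v : TangentSpace 𝓘(ℝ, E) x),
      ‖mfderiv 𝓘(ℝ, E) 𝓘(ℝ, E) F x v‖ = ‖v‖) (x y : M) : edist (F x) (F y) ≤ edist x y := by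
  rw [IsRiemannianManifold.out (I := 𝓘(ℝ, E)) x y, IsRiemannianManifold.out (I := 𝓘(ℝ, E)) (F x)]
  refine le_of_forall_gt fun r hr => ?_
  obtain ⟨γ, h0, h1, hγ, hlen⟩ := Manifold.exists_lt_of_riemannianEDist_lt hr
  have h2 := Manifold.riemannianEDist_le_pathELength (I := 𝓘(ℝ, E)) (x := F x) (y := F y)
    (γ := F ∘ γ) (hF.comp_contMDiffOn hγ) (by simp [h0]) (by simp [h1]) zero_le_one
  refine h2.trans_lt (lt_of_eq_of_lt ?_ hlen)
  rw [Manifold.pathELength_eq_lintegral_mfderivWithin_Icc,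
    Manifold.pathELength_eq_lintegral_mfderivWithin_Icc]
  refine MeasureTheory.setLIntegral_congr_fun measurableSet_Icc fun t ht => ?_
  have h3 : mfderivWithin 𝓘(ℝ, ℝ) 𝓘(ℝ, E) (F ∘ γ) (Set.Icc 0 1) t =
      (mfderiv 𝓘(ℝ, E) 𝓘(ℝ, E) F (γ t)).comp
        (mfderivWithin 𝓘(ℝ, ℝ) 𝓘(ℝ, E) γ (Set.Icc 0 1) t) := by
    refine mfderiv_comp_mfderivWithin t (hF.mdifferentiable one_ne_zero _)
      (hγ.mdifferentiableOn one_ne_zero t ht) ?_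
    rw [uniqueMDiffWithinAt_iff_uniqueDiffWithinAt]
    exact uniqueDiffOn_Icc zero_lt_one t ht
  have h4 : mfderivWithin 𝓘(ℝ, ℝ) 𝓘(ℝ, E) (F ∘ γ) (Set.Icc 0 1) t 1 =
      mfderiv 𝓘(ℝ, E) 𝓘(ℝ, E) F (γ t)
        (mfderivWithin 𝓘(ℝ, ℝ) 𝓘(ℝ, E) γ (Set.Icc 0 1) t 1) := congrArg (fun L => L 1) h3
  change ‖mfderivWithin 𝓘(ℝ, ℝ) 𝓘(ℝ, E) (F ∘ γ) (Set.Icc 0 1) t 1‖ₑ = _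
  rw [h4, ← ofReal_norm, ← ofReal_norm]
  exact congrArg ENNReal.ofReal (hnorm _ _)

theorem isIsometricSMul_of_norm_mfderiv_eq [IsManifold 𝓘(ℝ, E) 1 M] {G : Type*} [Group G]
    [MulAction G M] (hsmul : ∀ g : G, ContMDiff 𝓘(ℝ, E) 𝓘(ℝ, E) 1 fun y : M => g • y)
    (hisom : ∀ (g : G) (x : M) (v : TangentSpace 𝓘(ℝ, E) x),
      ‖mfderiv 𝓘(ℝ, E) 𝓘(ℝ, E) (fun y : M => g • y) x v‖ = ‖v‖) : IsIsometricSMul G M := by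
  refine ⟨fun g x y => le_antisymm (edist_le_of_norm_mfderiv_eq (hsmul g) (hisom g) x y) ?_⟩
  have := edist_le_of_norm_mfderiv_eq (hsmul g⁻¹) (hisom g⁻¹) (g • x) (g • y)
  rwa [inv_smul_smul, inv_smul_smul] at this

end Riemannian

/-! ### The distance to an orbit -/

section OrbitDist

variable {G M : Type*} [Group G] [EMetricSpace M] [MulAction G M]

theorem infEDist_smul_orbit [IsIsometricSMul G M] (x₀ : M) (g : G) (x : M) :
    Metric.infEDist (g • x) (MulAction.orbit G x₀) = Metric.infEDist x (MulAction.orbit G x₀) := by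
  conv_lhs => rw [← MulAction.smul_orbit g x₀]
  exact Metric.infEDist_smul g x _

variable [IsIsometricSMul G M]

/-- `M` itself may be disconnected, with infinite distances between components. The orbits
infinitely far from x₀ form a clopen subset of `M/G` that misses the orbit of x₀. -/
theorem infEDist_orbit_ne_top [ConnectedSpace (MulAction.orbitRel.Quotient G M)] (x₀ x : M) :
    Metric.infEDist x (MulAction.orbit G x₀) ≠ ⊤ := by
  let q : MulAction.orbitRel.Quotient G M → ENNReal :=
    Quotient.lift (fun x => Metric.infEDist x (MulAction.orbit G x₀)) fun x y hxy => by
      obtain ⟨a, rfl⟩ := hxy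
      exact infEDist_smul_orbit x₀ a y
  have hq : Continuous q := Metric.continuous_infEDist.quotient_lift _
  have hopen : IsOpen (q ⁻¹' {⊤}) := by
    rw [← isQuotientMap_quotient_mk'.isOpen_preimage, EMetric.isOpen_iff]
    refine fun x hx => ⟨⊤, ENNReal.zero_lt_top, fun y hy => ?_⟩
    have hx' : Metric.infEDist x (MulAction.orbit G x₀) = ⊤ := hx
    have h1 := Metric.infEDist_le_infEDist_add_edist (x := x) (y := y)
      (s := MulAction.orbit G x₀)
    rw [hx', top_le_iff, ENNReal.add_eq_top] at h1
    refine h1.resolve_right ?_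
    rw [edist_comm]
    exact (Metric.mem_eball.1 hy).ne
  have hclopen : IsClopen (q ⁻¹' {⊤}) := ⟨isClosed_singleton.preimage hq, hopen⟩
  rcases isClopen_iff.1 hclopen with h | h
  · intro hx
    have : (Quotient.mk _ x : MulAction.orbitRel.Quotient G M) ∈ q ⁻¹' {⊤} := hx
    rw [h] at this
    exact this
  · have : (Quotient.mk _ x₀ : MulAction.orbitRel.Quotient G M) ∈ q ⁻¹' {⊤} := h ▸ trivial
    have h0 : Metric.infEDist x₀ (MulAction.orbit G x₀) = ⊤ := this
    rw [Metric.infEDist_zero_of_mem (MulAction.mem_orbit_self x₀)] at h0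
    exact absurd h0 ENNReal.zero_ne_top

variable (G) in
/-- The distance to an orbit. -/
def orbitDist (x₀ x : M) : ℝ := (Metric.infEDist x (MulAction.orbit G x₀)).toReal

theorem orbitDist_smul (x₀ : M) (g : G) (x : M) : orbitDist G x₀ (g • x) = orbitDist G x₀ x := by
  rw [orbitDist, infEDist_smul_orbit, orbitDist]

variable [ConnectedSpace (MulAction.orbitRel.Quotient G M)]

variable (G) in
theorem lipschitzWith_orbitDist (x₀ : M) : LipschitzWith 1 (orbitDist G x₀) := by
  have h : ∀ x y : M, edist x y ≠ ⊤ →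
      orbitDist G x₀ x ≤ orbitDist G x₀ y + (edist x y).toReal := fun x y hxy => by
    rw [orbitDist, orbitDist, ← ENNReal.toReal_add (infEDist_orbit_ne_top x₀ y) hxy]
    exact ENNReal.toReal_mono (ENNReal.add_ne_top.2 ⟨infEDist_orbit_ne_top x₀ y, hxy⟩)
      Metric.infEDist_le_infEDist_add_edist
  intro x y
  rw [ENNReal.coe_one, one_mul]
  by_cases hxy : edist x y = ⊤
  · rw [hxy]; exact le_top
  have h1 := h x y hxy
  have h2 := h y x (by rwa [edist_comm])
  rw [edist_comm] at h2
  rw [edist_dist, Real.dist_eq]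
  refine ENNReal.ofReal_le_of_le_toReal (abs_le.2 ⟨by linarith, by linarith⟩)

variable (G) in
theorem exists_smul_mem_closedEBall {x₀ x : M} {ρ : ℝ} (hρ : orbitDist G x₀ x < ρ) :
    ∃ g : G, g • x ∈ Metric.closedEBall x₀ (ENNReal.ofReal ρ) := by
  have h1 := (ENNReal.lt_ofReal_iff_toReal_lt (infEDist_orbit_ne_top (G := G) x₀ x)).2 hρ
  obtain ⟨_, ⟨g, rfl⟩, hg⟩ := Metric.infEDist_lt_iff.1 h1
  refine ⟨g⁻¹, ?_⟩
  have h2 := edist_smul_left g (g⁻¹ • x) x₀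
  rw [smul_inv_smul] at h2
  rw [Metric.mem_closedEBall, ← h2]
  exact hg.le

theorem isCocompact_orbitDist_le [T2Space (Quotient (MulAction.orbitRel G M))]
    (hcpt : ∀ (x : M) (ρ : ℝ), IsCompact (Metric.closedEBall x (ENNReal.ofReal ρ)))
    (x₀ : M) (ρ : ℝ) : HigsonCorona.IsCocompact G {x : M | orbitDist G x₀ x ≤ ρ} := by
  have hc := (hcpt x₀ (ρ + 1)).image (continuous_quotient_mk' (s := MulAction.orbitRel G M))
  refine hc.closure_of_subset ?_
  rintro _ ⟨x, hx, rfl⟩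
  obtain ⟨g, hg⟩ := exists_smul_mem_closedEBall G (hx.trans_lt (lt_add_one ρ))
  exact ⟨_, hg, Quotient.sound ⟨g, rfl⟩⟩

variable (G) in
theorem exists_lt_orbitDist [hnc : NoncompactSpace (MulAction.orbitRel.Quotient G M)]
    (hcpt : ∀ (x : M) (ρ : ℝ), IsCompact (Metric.closedEBall x (ENNReal.ofReal ρ)))
    (x₀ : M) (C : ℝ) : ∃ x, C < orbitDist G x₀ x := by
  by_contra! hcon
  refine hnc.noncompact_univ ?_
  have hc := (hcpt x₀ (C + 1)).image (continuous_quotient_mk' (s := MulAction.orbitRel G M))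
  convert hc
  refine (Set.eq_univ_of_forall fun y => ?_).symm
  induction y using Quotient.inductionOn with
  | _ x =>
  obtain ⟨g, hg⟩ := exists_smul_mem_closedEBall G ((hcon x).trans_lt (lt_add_one C))
  exact ⟨_, hg, Quotient.sound ⟨g, rfl⟩⟩

theorem sigmaCompactSpace_quotient
    (hcpt : ∀ (x : M) (ρ : ℝ), IsCompact (Metric.closedEBall x (ENNReal.ofReal ρ))) (x₀ : M) :
    SigmaCompactSpace (MulAction.orbitRel.Quotient G M) := by
  refine ⟨fun n : ℕ =>
      Quotient.mk (MulAction.orbitRel G M) '' Metric.closedEBall x₀ (ENNReal.ofReal n),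
    fun n => (hcpt x₀ n).image (continuous_quotient_mk' (s := MulAction.orbitRel G M)),
    Set.eq_univ_of_forall fun y => ?_⟩
  induction y using Quotient.inductionOn with
  | _ x =>
  obtain ⟨n, hn⟩ := exists_nat_gt (orbitDist G x₀ x)
  obtain ⟨g, hg⟩ := exists_smul_mem_closedEBall G hn
  exact Set.mem_iUnion.2 ⟨n, _, hg, Quotient.sound ⟨g, rfl⟩⟩

end OrbitDist

/-! ### Smoothness of parametric integrals -/

section ParametricIntegral

open MeasureTheory

variable {F : Type*} [NormedAddCommGroup F] [NormedSpace ℝ F]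
  {T : Type*} [TopologicalSpace T] [ChartedSpace F T] [IsManifold 𝓘(ℝ, F) 1 T]
  {E : Type*} [NormedAddCommGroup E] [NormedSpace ℝ E] {U : Set E}

/-- The derivative in the second variable is read as that of the family z ↦ H t z with parameters
(t, y), taken along z = y; this gives smoothness jointly in t and y. -/
theorem contMDiffOn_fderiv_right (hU : IsOpen U) {H : T → E → ℝ}
    (hH : ContMDiffOn (𝓘(ℝ, F).prod 𝓘(ℝ, E)) 𝓘(ℝ, ℝ) ∞ (Function.uncurry H) (Set.univ ×ˢ U)) :
    ContMDiffOn (𝓘(ℝ, F).prod 𝓘(ℝ, E)) 𝓘(ℝ, E →L[ℝ] ℝ) ∞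
      (fun p : T × E => fderiv ℝ (H p.1) p.2) (Set.univ ×ˢ U) := by
  rintro ⟨t, y⟩ ⟨-, hy⟩
  have h1 : ContMDiffAt (𝓘(ℝ, F).prod 𝓘(ℝ, E)) 𝓘(ℝ, ℝ) ∞ (Function.uncurry H) (t, y) :=
    (hH (t, y) ⟨trivial, hy⟩).contMDiffAt ((isOpen_univ.prod hU).mem_nhds ⟨trivial, hy⟩)
  have h2 : ContMDiffAt ((𝓘(ℝ, F).prod 𝓘(ℝ, E)).prod 𝓘(ℝ, E)) 𝓘(ℝ, ℝ) ∞
      (Function.uncurry fun (p : T × E) (z : E) => H p.1 z) ((t, y), y) :=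
    ContMDiffAt.comp (I' := 𝓘(ℝ, F).prod 𝓘(ℝ, E)) ((t, y), y)
      (g := Function.uncurry H) (f := fun q : (T × E) × E => (q.1.1, q.2)) h1
      ((contMDiffAt_fst.fst).prodMk contMDiffAt_snd)
  have h3 := ContMDiffAt.mfderiv (m := ∞) (fun (p : T × E) (z : E) => H p.1 z) Prod.snd h2
    contMDiffAt_snd (by simp)
  simp only [mfderiv_eq_fderiv] at h3
  have h4 := inTangentCoordinates_model_space (I := 𝓘(ℝ, E)) (I' := 𝓘(ℝ, ℝ))
    (fun p : T × E => p.2) (fun p : T × E => H p.1 p.2)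
    (fun p : T × E => fderiv ℝ (H p.1) p.2) (t, y)
  rw [← h4]
  exact h3.contMDiffWithinAt

theorem continuousOn_slice {T E E' : Type*} [TopologicalSpace T] [TopologicalSpace E]
    [TopologicalSpace E'] {U : Set E} {H : T → E → E'}
    (hH : ContinuousOn (Function.uncurry H) (Set.univ ×ˢ U)) {y : E} (hy : y ∈ U) :
    Continuous fun t => H t y :=
  hH.comp_continuous (f := fun t => (t, y)) (by fun_prop) fun _ => ⟨trivial, hy⟩

theorem integrable_slice {T E : Type*} [TopologicalSpace T] [TopologicalSpace E] {U : Set E}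
    [MeasurableSpace T] [OpensMeasurableSpace T] {ν : Measure T} [IsFiniteMeasure ν] {K : Set T}
    (hK : IsCompact K) (hν : ∀ᵐ t ∂ν, t ∈ K)
    {E' : Type*} [NormedAddCommGroup E'] [SecondCountableTopology E'] {H : T → E → E'}
    (hH : ContinuousOn (Function.uncurry H) (Set.univ ×ˢ U)) {y : E} (hy : y ∈ U) :
    Integrable (fun t => H t y) ν := by
  have hc := continuousOn_slice hH hy
  obtain ⟨C, hC⟩ := hK.exists_bound_of_continuousOn hc.continuousOn
  refine (integrable_const C).mono' hc.aestronglyMeasurable ?_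
  filter_upwards [hν] with t ht using hC t ht

variable [MeasurableSpace T] [OpensMeasurableSpace T] [FiniteDimensional ℝ E]
  {ν : Measure T} [IsFiniteMeasure ν] {K : Set T}

/-- Differentiation under the integral: ν is finite and carried by the compact K, and the derivative
is bounded on K times a small closed ball. -/
theorem hasFDerivAt_integral_of_contMDiffOn (hU : IsOpen U) (hK : IsCompact K)
    (hν : ∀ᵐ t ∂ν, t ∈ K) {H : T → E → ℝ}
    (hH : ContMDiffOn (𝓘(ℝ, F).prod 𝓘(ℝ, E)) 𝓘(ℝ, ℝ) ∞ (Function.uncurry H) (Set.univ ×ˢ U))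
    {y : E} (hy : y ∈ U) :
    HasFDerivAt (fun y => ∫ t, H t y ∂ν) (∫ t, fderiv ℝ (H t) y ∂ν) y := by
  have hD := (contMDiffOn_fderiv_right hU hH).continuousOn
  obtain ⟨ε, hε, hsub⟩ := Metric.nhds_basis_closedBall.mem_iff.1 (hU.mem_nhds hy)
  obtain ⟨C, hC⟩ := (hK.prod (isCompact_closedBall y ε)).exists_bound_of_continuousOn
    (hD.mono (Set.prod_mono (Set.subset_univ K) hsub))
  refine hasFDerivAt_integral_of_dominated_of_fderiv_le (s := Metric.closedBall y ε)
    (F' := fun y t => fderiv ℝ (H t) y) (bound := fun _ => C)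
    (Metric.closedBall_mem_nhds y hε) ?_ ?_ ?_ ?_ (integrable_const C) ?_
  · filter_upwards [hU.mem_nhds hy] with z hz
      using (continuousOn_slice hH.continuousOn hz).aestronglyMeasurable
  · exact integrable_slice hK hν hH.continuousOn hy
  · exact (continuousOn_slice (H := fun t y => fderiv ℝ (H t) y) hD hy).aestronglyMeasurable
  · filter_upwards [hν] with t ht z hz using hC (t, z) ⟨ht, hz⟩
  · refine Filter.Eventually.of_forall fun t z hz => DifferentiableAt.hasFDerivAt ?_
    have h1 : ContMDiffAt 𝓘(ℝ, E) 𝓘(ℝ, ℝ) ∞ (H t) z :=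
      ContMDiffAt.comp (I' := 𝓘(ℝ, F).prod 𝓘(ℝ, E)) z (g := Function.uncurry H)
        (f := fun z => (t, z))
        ((hH (t, z) ⟨trivial, hsub hz⟩).contMDiffAt
          ((isOpen_univ.prod hU).mem_nhds ⟨trivial, hsub hz⟩))
        (contMDiffAt_const.prodMk contMDiffAt_id)
    exact h1.contDiffAt.differentiableAt (by simp)

theorem contDiffOn_integral_of_contMDiffOn (hU : IsOpen U) (hK : IsCompact K)
    (hν : ∀ᵐ t ∂ν, t ∈ K) {H : T → E → ℝ}
    (hH : ContMDiffOn (𝓘(ℝ, F).prod 𝓘(ℝ, E)) 𝓘(ℝ, ℝ) ∞ (Function.uncurry H) (Set.univ ×ˢ U)) :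
    ContDiffOn ℝ ∞ (fun y => ∫ t, H t y ∂ν) U := by
  refine contDiffOn_infty.2 fun n => ?_
  induction n generalizing H with
  | zero =>
    refine contDiffOn_zero.2 fun y hy => ?_
    exact (hasFDerivAt_integral_of_contMDiffOn hU hK hν hH hy).continuousAt.continuousWithinAt
  | succ n ih =>
    rw [Nat.cast_succ]
    -- Each directional derivative is again an integral of the same kind, with integrand the
    -- directional derivative of H, so the induction hypothesis applies to it.
    refine contDiffOn_succ_of_fderiv_apply (fun y hy =>
      (hasFDerivAt_integral_of_contMDiffOn hU hK hν hH hy).differentiableAt.differentiableWithinAt)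
      (fun h => absurd h (WithTop.natCast_ne_top n)) fun v => ?_
    have hD := contMDiffOn_fderiv_right hU hH
    have hDv : ContMDiffOn (𝓘(ℝ, F).prod 𝓘(ℝ, E)) 𝓘(ℝ, ℝ) ∞
        (Function.uncurry fun t y => fderiv ℝ (H t) y v) (Set.univ ×ˢ U) :=
      (ContinuousLinearMap.apply ℝ ℝ v).contMDiff.comp_contMDiffOn hD
    refine (ih hDv).congr fun y hy => ?_
    rw [fderivWithin_of_isOpen hU hy, (hasFDerivAt_integral_of_contMDiffOn hU hK hν hH hy).fderiv,
      ContinuousLinearMap.integral_apply]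
    exact integrable_slice (H := fun t y => fderiv ℝ (H t) y) hK hν hD.continuousOn hy

end ParametricIntegral

/-! ### Averaging over a group -/

section RealDifferential

variable (E : Type*) [NormedAddCommGroup E] [NormedSpace ℝ E]
  {M : Type*} [TopologicalSpace M] [ChartedSpace E M]

/-- The differential of a real valued function at `x`, as a real linear map `T_x M → ℝ`. -/
def rdAt (f : M → ℝ) (x : M) : TangentSpace 𝓘(ℝ, E) x →L[ℝ] ℝ :=
  mfderiv 𝓘(ℝ, E) 𝓘(ℝ, ℝ) f x

variable {E}

theorem rdAt_apply_eq_fderiv {f : M → ℝ} {x : M} (hf : MDifferentiableAt 𝓘(ℝ, E) 𝓘(ℝ, ℝ) f x)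
    (v : TangentSpace 𝓘(ℝ, E) x) :
    rdAt E f x v =
      fderiv ℝ (f ∘ (extChartAt 𝓘(ℝ, E) x).symm) (extChartAt 𝓘(ℝ, E) x x) (v : E) := by
  have h : mfderiv 𝓘(ℝ, E) 𝓘(ℝ, ℝ) f x =
      fderiv ℝ (f ∘ (extChartAt 𝓘(ℝ, E) x).symm) (extChartAt 𝓘(ℝ, E) x x) := by
    simp only [mfderiv, hf, ← fderivWithin_univ, ModelWithCorners.range_eq_univ]
    rfl
  exact congrArg (fun L : E →L[ℝ] ℝ => L v) h

theorem rdAt_comp {F : M → M} {f : M → ℝ} {x : M}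
    (hf : MDifferentiableAt 𝓘(ℝ, E) 𝓘(ℝ, ℝ) f (F x))
    (hF : MDifferentiableAt 𝓘(ℝ, E) 𝓘(ℝ, E) F x) (v : TangentSpace 𝓘(ℝ, E) x) :
    rdAt E (fun y => f (F y)) x v =
      rdAt E f (F x) (mfderiv 𝓘(ℝ, E) 𝓘(ℝ, E) F x v) :=
  congrArg (fun L : TangentSpace 𝓘(ℝ, E) x →L[ℝ] ℝ => L v) (mfderiv_comp x hf hF)

variable (E) in
/-- The gradient of `f` at `x` has norm at most `C`. -/
def GradBound [Bundle.RiemannianBundle (fun x : M => TangentSpace 𝓘(ℝ, E) x)]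
    (f : M → ℝ) (x : M) (C : ℝ) : Prop :=
  ∀ v : TangentSpace 𝓘(ℝ, E) x, |rdAt E f x v| ≤ C * ‖v‖

end RealDifferential

section Averaging

open MeasureTheory
open scoped Pointwise

/-- The average of a function over the orbits. -/
def orbitAverage {G M : Type*} [Group G] [MeasurableSpace G] (μ : Measure G) [MulAction G M]
    (k : M → ℝ) (x : M) : ℝ :=
  ∫ g, k (g⁻¹ • x) ∂μ

/-- Substituting hg for g cancels h, since (hg)⁻¹h = g⁻¹. The inverse in the definition is what
makes left invariance of μ the right condition. -/
theorem orbitAverage_smul {G M : Type*} [Group G] [MeasurableSpace G] [MeasurableMul G]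
    (μ : Measure G) [MulAction G M] [μ.IsMulLeftInvariant] (k : M → ℝ) (h : G) (x : M) :
    orbitAverage μ k (h • x) = orbitAverage μ k x := by
  rw [orbitAverage, ← integral_mul_left_eq_self _ h, orbitAverage]
  simp only [mul_inv_rev, mul_smul, inv_smul_smul]

section Proper

variable {G : Type*} [TopologicalSpace G] [Group G] [IsTopologicalGroup G]
  {M : Type*} [TopologicalSpace M] [MulAction G M] [ProperSMul G M]

theorem isCompact_closure_setOf_smul_inter {S N : Set M} (hS : IsCompact S) (hN : IsCompact N) :
    IsCompact (closure {g : G | (g • S ∩ N).Nonempty}) :=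
  (ProperSMul.isCompact_setOfPred_inter_nonempty hS hN).closure

theorem hasCompactSupport_inv_smul {k : M → ℝ} (hk : HasCompactSupport k) (x : M) :
    HasCompactSupport fun g : G => k (g⁻¹ • x) := by
  refine HasCompactSupport.intro (K := closure {g : G | (g • tsupport k ∩ {x}).Nonempty})
    (isCompact_closure_setOf_smul_inter hk isCompact_singleton) fun g hg => ?_
  by_contra hne
  refine hg (subset_closure ⟨x, ?_, rfl⟩)
  rw [Set.mem_smul_set_iff_inv_smul_mem]
  exact subset_tsupport _ hne

variable [MeasurableSpace G] [BorelSpace G] (μ : Measure G) [IsFiniteMeasureOnCompacts μ]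

theorem integrable_inv_smul {k : M → ℝ} (hc : Continuous k) (hk : HasCompactSupport k) (x : M) :
    Integrable (fun g : G => k (g⁻¹ • x)) μ :=
  Continuous.integrable_of_hasCompactSupport (by fun_prop) (hasCompactSupport_inv_smul hk x)

/-- The measure of the set of group elements that move a point into a compact set is bounded. -/
theorem exists_measure_inv_smul_mem_le [μ.IsMulLeftInvariant] {S : Set M} (hS : IsCompact S) :
    ∃ m : ℝ, 0 ≤ m ∧ ∀ x, ∃ A : Set G, MeasurableSet A ∧ (∀ g, g⁻¹ • x ∈ S → g ∈ A) ∧ μ A ≠ ⊤ ∧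
      μ.real A ≤ m := by
  -- If h⁻¹x lies in S, any g with g⁻¹x in S satisfies h⁻¹g ∈ A₀. So such g lie in the translate
  -- hA₀, whose measure does not depend on x.
  set A₀ := closure {g : G | (g • S ∩ S).Nonempty} with hA₀
  have hA₀c : IsCompact A₀ := isCompact_closure_setOf_smul_inter hS hS
  refine ⟨μ.real A₀, measureReal_nonneg, fun x => ?_⟩
  by_cases hx : ∃ h : G, h⁻¹ • x ∈ S
  · obtain ⟨h, hh⟩ := hx
    have hpre : μ ((fun g => h⁻¹ * g) ⁻¹' A₀) = μ A₀ := measure_preimage_mul μ h⁻¹ A₀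
    refine ⟨(fun g => h⁻¹ * g) ⁻¹' A₀,
      (isClosed_closure.preimage (continuous_const_mul _)).measurableSet,
      fun g hg => subset_closure ⟨h⁻¹ • x, ?_, hh⟩, ?_, ?_⟩
    · rw [Set.mem_smul_set_iff_inv_smul_mem]
      simpa [mul_smul] using hg
    · rw [hpre]; exact hA₀c.measure_lt_top.ne
    · rw [measureReal_def, hpre, measureReal_def]
  · push Not at hx
    exact ⟨∅, MeasurableSet.empty, fun g hg => absurd hg (hx g), by simp, by simp⟩

variable (EG : Type*) [NormedAddCommGroup EG] [NormedSpace ℝ EG] [ChartedSpace EG G]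
  [LieGroup 𝓘(ℝ, EG) ∞ G]
  {E : Type*} [NormedAddCommGroup E] [NormedSpace ℝ E] [FiniteDimensional ℝ E]
  [ChartedSpace E M] [IsManifold 𝓘(ℝ, E) ∞ M] [LocallyCompactSpace M]
  [ContMDiffSMul 𝓘(ℝ, EG) 𝓘(ℝ, E) ∞ G M]

include EG

/-- By properness only g in one compact set A contribute at points near x. In a chart the average
becomes an integral over A depending smoothly on parameters, and the chain rule identifies the
differentiated integrand. -/
theorem contMDiffAt_orbitAverage_and_rdAt {k : M → ℝ} (hk : ContMDiff 𝓘(ℝ, E) 𝓘(ℝ, ℝ) ∞ k)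
    (hkc : HasCompactSupport k) (x : M) :
    ContMDiffAt 𝓘(ℝ, E) 𝓘(ℝ, ℝ) ∞ (orbitAverage μ k) x ∧
      ∃ A : Set G, ∀ v : TangentSpace 𝓘(ℝ, E) x, rdAt E (orbitAverage μ k) x v =
        ∫ g in A, rdAt E k (g⁻¹ • x)
          (mfderiv 𝓘(ℝ, E) 𝓘(ℝ, E) (fun y : M => g⁻¹ • y) x v) ∂μ := by
  set e := extChartAt 𝓘(ℝ, E) x with he
  obtain ⟨N, hN, hxN⟩ := exists_compact_mem_nhds x
  set A := closure {g : G | (g • tsupport k ∩ N).Nonempty} with hA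
  have hAc : IsCompact A := isCompact_closure_setOf_smul_inter hkc hN
  set U : Set E := e.target ∩ e.symm ⁻¹' interior N with hUdef
  have hU : IsOpen U :=
    (continuousOn_extChartAt_symm x).isOpen_inter_preimage (isOpen_extChartAt_target x)
      isOpen_interior
  have hxU : e x ∈ U := by
    refine ⟨mem_extChartAt_target x, ?_⟩
    rw [Set.mem_preimage, he, extChartAt_to_inv]
    exact mem_interior_iff_mem_nhds.2 hxN
  have : IsFiniteMeasure (μ.restrict A) := ⟨by
    rw [Measure.restrict_apply_univ]; exact hAc.measure_lt_top⟩
  have hae : ∀ᵐ g ∂(μ.restrict A), g ∈ A := ae_restrict_mem isClosed_closure.measurableSet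
  let H : G → E → ℝ := fun g y => k (g⁻¹ • e.symm y)
  have hmul : ContMDiff (𝓘(ℝ, EG).prod 𝓘(ℝ, E)) 𝓘(ℝ, E) ∞ fun p : G × M => p.1⁻¹ • p.2 :=
    (ContMDiffSMul.contMDiff_smul (I := 𝓘(ℝ, EG)) (I' := 𝓘(ℝ, E)) (G := G) (M := M)).comp
      (((contMDiff_inv 𝓘(ℝ, EG) ∞).comp contMDiff_fst).prodMk contMDiff_snd)
  have hH : ContMDiffOn (𝓘(ℝ, EG).prod 𝓘(ℝ, E)) 𝓘(ℝ, ℝ) ∞ (Function.uncurry H)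
      (Set.univ ×ˢ U) := by
    refine (hk.comp hmul).comp_contMDiffOn (f := fun p : G × E => (p.1, e.symm p.2)) ?_
    refine contMDiffOn_fst.prodMk ((contMDiffOn_extChartAt_symm x).comp contMDiffOn_snd ?_)
    exact fun p hp => hp.2.1
  have hIM : IsManifold 𝓘(ℝ, EG) 1 G :=
    IsManifold.of_le (n := ∞) (by exact_mod_cast le_top)
  have heq : ∀ z ∈ interior N, orbitAverage μ k z = ∫ g in A, k (g⁻¹ • z) ∂μ := fun z hz => by
    refine (setIntegral_eq_integral_of_forall_compl_eq_zero fun g hg => ?_).symm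
    by_contra hne
    refine hg (subset_closure ⟨z, ?_, interior_subset hz⟩)
    rw [Set.mem_smul_set_iff_inv_smul_mem]
    exact subset_tsupport _ hne
  have hcd := contDiffOn_integral_of_contMDiffOn hU hAc hae hH
  have hfd := hasFDerivAt_integral_of_contMDiffOn hU hAc hae hH hxU
  have hsm : ContMDiffAt 𝓘(ℝ, E) 𝓘(ℝ, ℝ) ∞ (orbitAverage μ k) x := by
    have h1 : ContMDiffAt 𝓘(ℝ, E) 𝓘(ℝ, ℝ) ∞ (fun z => ∫ g in A, H g (e z) ∂μ) x :=
      ContMDiffAt.comp x (g := fun y => ∫ g in A, H g y ∂μ)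
        ((hcd.contDiffAt (hU.mem_nhds hxU)).contMDiffAt) contMDiffAt_extChartAt
    refine h1.congr_of_eventuallyEq ?_
    filter_upwards [interior_mem_nhds.2 hxN, extChartAt_source_mem_nhds (I := 𝓘(ℝ, E)) x]
      with z hz hz'
    rw [heq z hz]
    simp only [H, he, (extChartAt 𝓘(ℝ, E) x).left_inv hz']
  refine ⟨hsm, A, fun v => ?_⟩
  rw [rdAt_apply_eq_fderiv (hsm.mdifferentiableAt (by simp))]
  have h2 : orbitAverage μ k ∘ e.symm =ᶠ[nhds (e x)] fun y => ∫ g in A, H g y ∂μ := by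
    filter_upwards [hU.mem_nhds hxU] with y hy using heq _ hy.2
  rw [h2.fderiv_eq, hfd.fderiv]
  have h5 : ∀ w : E, (∫ g in A, fderiv ℝ (H g) (e x) ∂μ) w =
      ∫ g in A, fderiv ℝ (H g) (e x) w ∂μ := ContinuousLinearMap.integral_apply
    (integrable_slice (H := fun g y => fderiv ℝ (H g) y) hAc hae
      (contMDiffOn_fderiv_right hU hH).continuousOn hxU)
  refine (h5 v).trans (integral_congr_ae (Filter.Eventually.of_forall fun g => ?_))
  have hg : ContMDiff 𝓘(ℝ, E) 𝓘(ℝ, E) ∞ fun y : M => g⁻¹ • y :=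
    hmul.comp (contMDiff_const.prodMk contMDiff_id)
  have h3 := rdAt_apply_eq_fderiv (((hk.comp hg).mdifferentiable (by simp)) x) v
  have h4 := rdAt_comp ((hk.mdifferentiable (by simp)) (g⁻¹ • x))
    ((hg.mdifferentiable (by simp)) x) v
  exact h3.symm.trans h4

theorem contMDiff_orbitAverage {k : M → ℝ} (hk : ContMDiff 𝓘(ℝ, E) 𝓘(ℝ, ℝ) ∞ k)
    (hkc : HasCompactSupport k) : ContMDiff 𝓘(ℝ, E) 𝓘(ℝ, ℝ) ∞ (orbitAverage μ k) :=
  fun x => (contMDiffAt_orbitAverage_and_rdAt μ EG hk hkc x).1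

variable [Bundle.RiemannianBundle (fun x : M => TangentSpace 𝓘(ℝ, E) x)]

/-- As g⁻¹ acts isometrically, a gradient bound for k at g⁻¹x bounds the gradient of k ∘ g⁻¹ at x.
These bounds are then integrated. -/
theorem gradBound_orbitAverage {k : M → ℝ} (hk : ContMDiff 𝓘(ℝ, E) 𝓘(ℝ, ℝ) ∞ k)
    (hkc : HasCompactSupport k)
    (hisom : ∀ (g : G) (x : M) (v : TangentSpace 𝓘(ℝ, E) x),
      ‖mfderiv 𝓘(ℝ, E) 𝓘(ℝ, E) (fun y : M => g • y) x v‖ = ‖v‖) {x : M} {B : G → ℝ}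
    (hB0 : ∀ g, 0 ≤ B g) (hB : ∀ g : G, GradBound E k (g⁻¹ • x) (B g)) (hBi : Integrable B μ) :
    GradBound E (orbitAverage μ k) x (∫ g, B g ∂μ) := by
  intro v
  obtain ⟨-, A, hA⟩ := contMDiffAt_orbitAverage_and_rdAt μ EG hk hkc x
  rw [hA, ← integral_mul_const]
  refine (norm_integral_le_of_norm_le (G := ℝ) ((hBi.mul_const ‖v‖).restrict)
    (Filter.Eventually.of_forall fun g => ?_)).trans
    (setIntegral_le_integral (hBi.mul_const ‖v‖)
      (Filter.Eventually.of_forall fun g => mul_nonneg (hB0 g) (norm_nonneg v)))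
  have h1 := hB g (mfderiv 𝓘(ℝ, E) 𝓘(ℝ, E) (fun y : M => g⁻¹ • y) x v)
  rw [hisom] at h1
  exact h1

end Proper

end Averaging

/-! ### Local smoothing of Lipschitz functions on Riemannian manifolds -/

section Charts

variable {E : Type*} [NormedAddCommGroup E] [NormedSpace ℝ E]

theorem IsContMDiffRiemannianBundle.isContinuousRiemannianBundle
    {M : Type*} [TopologicalSpace M] [ChartedSpace E M] [IsManifold 𝓘(ℝ, E) 1 M]
    [Bundle.RiemannianBundle (fun x : M => TangentSpace 𝓘(ℝ, E) x)]
    [IsContMDiffRiemannianBundle 𝓘(ℝ, E) ∞ E (fun x : M => TangentSpace 𝓘(ℝ, E) x)] :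
    IsContinuousRiemannianBundle E (fun x : M => TangentSpace 𝓘(ℝ, E) x) := by
  obtain ⟨g, hg, h⟩ := IsContMDiffRiemannianBundle.exists_contMDiff (IB := 𝓘(ℝ, E)) (n := ∞)
    (F := E) (E := fun x : M => TangentSpace 𝓘(ℝ, E) x)
  exact ⟨g, hg.continuous, h⟩

/-- Near each point, the chart distorts the Riemannian norm by a factor at most two. -/
theorem exists_chart_seminorm {M : Type*} [TopologicalSpace M] [ChartedSpace E M]
    [IsManifold 𝓘(ℝ, E) 1 M] [Bundle.RiemannianBundle (fun x : M => TangentSpace 𝓘(ℝ, E) x)]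
    [IsContinuousRiemannianBundle E (fun x : M => TangentSpace 𝓘(ℝ, E) x)] (p : M) :
    ∃ (N : Seminorm ℝ E) (C : ℝ), 0 < C ∧ (∀ w, N w ≤ C * ‖w‖) ∧
      (∀ᶠ z in nhds (extChartAt 𝓘(ℝ, E) p p), z ∈ (extChartAt 𝓘(ℝ, E) p).target ∧
        ∀ w : TangentSpace 𝓘(ℝ, E) z,
          ‖mfderiv 𝓘(ℝ, E) 𝓘(ℝ, E) (extChartAt 𝓘(ℝ, E) p).symm z w‖ ≤ 2 * N w) ∧
      ∀ᶠ y in nhds p, y ∈ (extChartAt 𝓘(ℝ, E) p).source ∧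
        ∀ v : TangentSpace 𝓘(ℝ, E) y,
          N (mfderiv 𝓘(ℝ, E) 𝓘(ℝ, E) (extChartAt 𝓘(ℝ, E) p) y v) ≤ 2 * ‖v‖ := by
  set tr := trivializationAt E (fun x : M => TangentSpace 𝓘(ℝ, E) x) p with htr
  have hp : p ∈ tr.baseSet := FiberBundle.mem_baseSet_trivializationAt' p
  -- N is the Riemannian norm at p carried to the model space by the trivialization; continuity of
  -- the metric makes it comparable to the norms at nearby points.
  let N : Seminorm ℝ E :=
    (normSeminorm ℝ (TangentSpace 𝓘(ℝ, E) p)).comp (tr.symmL ℝ p).toLinearMap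
  refine ⟨N, ‖tr.symmL ℝ p‖ + 1, by positivity, fun w => ?_, ?_, ?_⟩
  · refine ((tr.symmL ℝ p).le_opNorm w).trans ?_
    gcongr
    linarith
  · have h0 : ∀ᶠ y in nhds p, ∀ w : E, ‖tr.symmL ℝ y w‖ ≤ 2 * N w := by
      filter_upwards [eventually_norm_symmL_trivializationAt_comp_self_lt E
        (fun x : M => TangentSpace 𝓘(ℝ, E) x) p one_lt_two] with y h2 w
      have h3 := ContinuousLinearMap.le_of_opNorm_le _ h2.le (tr.symmL ℝ p w)
      have h4 : tr.continuousLinearMapAt ℝ p (tr.symmL ℝ p w) = w :=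
        tr.continuousLinearMapAt_symmL hp w
      rw [ContinuousLinearMap.comp_apply, h4] at h3
      exact h3
    have h1 : Filter.Tendsto (extChartAt 𝓘(ℝ, E) p).symm (nhds (extChartAt 𝓘(ℝ, E) p p))
        (nhds p) := by
      have := (continuousAt_extChartAt_symm (I := 𝓘(ℝ, E)) p).tendsto
      rwa [extChartAt_to_inv] at this
    filter_upwards [h1.eventually h0, extChartAt_target_mem_nhds (I := 𝓘(ℝ, E)) p]
      with z hz hzt
    refine ⟨hzt, fun w => ?_⟩
    have hsrc : (extChartAt 𝓘(ℝ, E) p).symm z ∈ (chartAt E p).source := by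
      rw [← extChartAt_source 𝓘(ℝ, E)]
      exact (extChartAt 𝓘(ℝ, E) p).map_target hzt
    have h2 : (tr.symmL ℝ ((extChartAt 𝓘(ℝ, E) p).symm z) w : E) =
        mfderiv 𝓘(ℝ, E) 𝓘(ℝ, E) (extChartAt 𝓘(ℝ, E) p).symm z w := by
      have h3 := TangentBundle.symmL_trivializationAt (I := 𝓘(ℝ, E)) hsrc
      rw [ModelWithCorners.range_eq_univ, mfderivWithin_univ] at h3
      have h4 : ∀ z', z' = z → (mfderiv 𝓘(ℝ, E) 𝓘(ℝ, E) (extChartAt 𝓘(ℝ, E) p).symm z' w : E) =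
          mfderiv 𝓘(ℝ, E) 𝓘(ℝ, E) (extChartAt 𝓘(ℝ, E) p).symm z w := by
        rintro _ rfl; rfl
      exact (congrArg (fun L : E →L[ℝ] E => L w) h3).trans
        (h4 _ ((extChartAt 𝓘(ℝ, E) p).right_inv hzt))
    refine le_trans (le_of_eq ?_) (hz w)
    exact congrArg (fun u : TangentSpace 𝓘(ℝ, E) ((extChartAt 𝓘(ℝ, E) p).symm z) => ‖u‖) h2.symm
  · filter_upwards [extChartAt_source_mem_nhds (I := 𝓘(ℝ, E)) p,
      eventually_norm_symmL_trivializationAt_self_comp_lt E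
        (fun x : M => TangentSpace 𝓘(ℝ, E) x) p one_lt_two] with y hy h1
    refine ⟨hy, fun v => ?_⟩
    rw [extChartAt_source] at hy
    have h2 := TangentBundle.continuousLinearMapAt_trivializationAt (I := 𝓘(ℝ, E)) hy
    have h3 : (tr.continuousLinearMapAt ℝ y v : E) =
        mfderiv 𝓘(ℝ, E) 𝓘(ℝ, E) (extChartAt 𝓘(ℝ, E) p) y v :=
      congrArg (fun L : TangentSpace 𝓘(ℝ, E) y →L[ℝ] E => L v) h2
    refine le_trans (le_of_eq (congrArg N h3.symm)) ?_
    exact ContinuousLinearMap.le_of_opNorm_le _ h1.le v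

variable {M : Type*} [EMetricSpace M] [ChartedSpace E M] [IsManifold 𝓘(ℝ, E) ∞ M]
  [Bundle.RiemannianBundle (fun x : M => TangentSpace 𝓘(ℝ, E) x)]
  [IsRiemannianManifold 𝓘(ℝ, E) M]

/-- The chart image of the straight segment from a to b is a curve whose speed is at most 2 N(b -
a). -/
theorem edist_extChartAt_symm_le {p : M} {N : Seminorm ℝ E} {B : Set E} (hB : Convex ℝ B)
    (h : ∀ z ∈ B, z ∈ (extChartAt 𝓘(ℝ, E) p).target ∧ ∀ w : TangentSpace 𝓘(ℝ, E) z,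
      ‖mfderiv 𝓘(ℝ, E) 𝓘(ℝ, E) (extChartAt 𝓘(ℝ, E) p).symm z w‖ ≤ 2 * N w)
    {a b : E} (ha : a ∈ B) (hb : b ∈ B) :
    edist ((extChartAt 𝓘(ℝ, E) p).symm a) ((extChartAt 𝓘(ℝ, E) p).symm b) ≤
      ENNReal.ofReal (2 * N (b - a)) := by
  let η : ℝ → E := fun t => a + t • (b - a)
  have hη : ∀ t ∈ Set.Icc (0 : ℝ) 1, η t ∈ B := fun t ht =>
    hB.add_smul_sub_mem ha hb ht
  have hηc : ContMDiff 𝓘(ℝ, ℝ) 𝓘(ℝ, E) 1 η := by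
    rw [contMDiff_iff_contDiff]
    fun_prop
  have hηd : ∀ t, HasDerivAt η (b - a) t := fun t => by
    have := ((hasDerivAt_id t).smul_const (b - a)).const_add a
    rwa [one_smul] at this
  rw [IsRiemannianManifold.out (I := 𝓘(ℝ, E))]
  refine (Manifold.riemannianEDist_le_pathELength (a := 0) (b := 1)
    (γ := (extChartAt 𝓘(ℝ, E) p).symm ∘ η) ?_ (by simp [η]) (by simp [η]) zero_le_one).trans ?_
  · exact ((contMDiffOn_extChartAt_symm (n := ∞) p).of_le (by exact_mod_cast le_top)).comp
      hηc.contMDiffOn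
      fun t ht => (h _ (hη t ht)).1
  · rw [Manifold.pathELength_eq_lintegral_mfderiv_Icc]
    refine (MeasureTheory.setLIntegral_mono' measurableSet_Icc
      (g := fun _ => ENNReal.ofReal (2 * N (b - a))) fun t ht => ?_).trans (by simp)
    have hz := h _ (hη t ht)
    have hd : MDifferentiableAt 𝓘(ℝ, E) 𝓘(ℝ, E) (extChartAt 𝓘(ℝ, E) p).symm (η t) :=
      ((contMDiffOn_extChartAt_symm (n := ∞) p _ hz.1).contMDiffAt
        ((isOpen_extChartAt_target p).mem_nhds hz.1)).mdifferentiableAt (by simp)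
    have h1 := mfderiv_comp t hd (hηc.mdifferentiable one_ne_zero t)
    have h2 : (mfderiv 𝓘(ℝ, ℝ) 𝓘(ℝ, E) η t (1 : ℝ) : E) = b - a := by
      have : fderiv ℝ η t 1 = b - a := by
        rw [fderiv_apply_one_eq_deriv, (hηd t).deriv]
      rwa [← mfderiv_eq_fderiv] at this
    have h3 : mfderiv 𝓘(ℝ, ℝ) 𝓘(ℝ, E) ((extChartAt 𝓘(ℝ, E) p).symm ∘ η) t (1 : ℝ) =
        mfderiv 𝓘(ℝ, E) 𝓘(ℝ, E) (extChartAt 𝓘(ℝ, E) p).symm (η t) (b - a) := by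
      rw [h1]
      exact congrArg (mfderiv 𝓘(ℝ, E) 𝓘(ℝ, E) (extChartAt 𝓘(ℝ, E) p).symm (η t)) h2
    refine le_trans (le_of_eq ?_) (ENNReal.ofReal_le_ofReal (hz.2 (b - a)))
    rw [ofReal_norm]
    exact congrArg (fun u : TangentSpace 𝓘(ℝ, E) ((extChartAt 𝓘(ℝ, E) p).symm (η t)) => ‖u‖ₑ) h3

end Charts

/-! ### Smoothing by convolution in a vector space -/

section Convolution

open MeasureTheory

variable {E : Type*} [NormedAddCommGroup E] [NormedSpace ℝ E]

theorem norm_fderiv_apply_le_of_seminorm {f : E → ℝ} {N : Seminorm ℝ E} {C : ℝ} (hC : 0 ≤ C)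
    {V : Set E} {a : E} (hV : V ∈ nhds a) (hf : DifferentiableAt ℝ f a)
    (hlip : ∀ b ∈ V, |f b - f a| ≤ C * N (b - a)) (w : E) : |fderiv ℝ f a w| ≤ C * N w := by
  have hl : HasDerivAt (fun s : ℝ => a + s • w) w 0 := by
    have := ((hasDerivAt_id (0 : ℝ)).smul_const w).const_add a
    rwa [one_smul] at this
  have h1 : HasDerivAt (fun s : ℝ => f (a + s • w)) (fderiv ℝ f a w) 0 := by
    refine HasFDerivAt.comp_hasDerivAt 0 ?_ hl
    simpa using hf.hasFDerivAt
  have hV' : ∀ᶠ s : ℝ in nhds 0, a + s • w ∈ V :=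
    hl.continuousAt.eventually_mem (by simpa using hV)
  refine h1.le_of_lip' (mul_nonneg hC (apply_nonneg N w)) ?_
  filter_upwards [hV'] with s hs
  have h2 := hlip _ hs
  rw [add_sub_cancel_left, map_smul_eq_mul] at h2
  rw [zero_smul, add_zero, sub_zero]
  refine h2.trans (le_of_eq ?_)
  ring

variable [FiniteDimensional ℝ E]

/-- Smoothing of a locally Lipschitz function on a ball. -/
theorem exists_contDiff_near_of_lipschitz {f : E → ℝ} {N : Seminorm ℝ E} {C L R : ℝ}
    (hL : 0 ≤ L) (hR : 0 < R) (hC : 0 < C) (hN : ∀ w, N w ≤ C * ‖w‖) {c : E}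
    (hlip : ∀ a ∈ Metric.ball c (4 * R), ∀ b ∈ Metric.ball c (4 * R),
      |f b - f a| ≤ L * N (b - a)) {δ : ℝ} (hδ : 0 < δ) :
    ∃ h : E → ℝ, ContDiff ℝ ∞ h ∧ (∀ a ∈ Metric.ball c R, |h a - f a| ≤ δ) ∧
      ∀ a ∈ Metric.ball c R, ∀ w, |fderiv ℝ h a w| ≤ L * N w := by
  let _ : MeasurableSpace E := borel E
  have _ : BorelSpace E := ⟨rfl⟩
  let μ : Measure E := Measure.addHaar
  set K := Metric.closedBall c (2 * R) with hK
  have hKsub : K ⊆ Metric.ball c (4 * R) := Metric.closedBall_subset_ball (by linarith)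
  have hcont : ContinuousOn f K := by
    intro a ha
    have h0 : Filter.Tendsto (fun b => L * (C * ‖b - a‖)) (nhdsWithin a K) (nhds 0) := by
      have : Continuous fun b => L * (C * ‖b - a‖) := by fun_prop
      simpa using (this.tendsto a).mono_left nhdsWithin_le_nhds
    refine tendsto_iff_dist_tendsto_zero.2 (squeeze_zero' (.of_forall fun _ => dist_nonneg) ?_ h0)
    filter_upwards [self_mem_nhdsWithin] with b hb
    rw [Real.dist_eq]
    exact (hlip a (hKsub ha) b (hKsub hb)).trans (by gcongr; exact hN _)
  set F : E → ℝ := K.indicator f with hF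
  have hFint : Integrable F μ :=
    (hcont.integrableOn_compact (isCompact_closedBall c _)).integrable_indicator
      Metric.isClosed_closedBall.measurableSet
  have hFlip : ∀ a ∈ K, ∀ b ∈ K, |F b - F a| ≤ L * N (b - a) := fun a ha b hb => by
    rw [hF, Set.indicator_of_mem ha, Set.indicator_of_mem hb]
    exact hlip a (hKsub ha) b (hKsub hb)
  -- ρ ≤ R keeps translates of the R-ball inside K, and LCρ ≤ δ bounds the displacement of values.
  -- The +1 covers L = 0.
  set ρ := min R (δ / (L * C + 1)) with hρ
  have hLC : 0 ≤ L * C := by positivity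
  have hρ0 : 0 < ρ := lt_min hR (by positivity)
  let φ : ContDiffBump (0 : E) := ⟨ρ / 2, ρ, by positivity, by linarith⟩
  have hφsupp : ∀ t, φ.normed μ t ≠ 0 → ‖t‖ < R := fun t ht => by
    have h1 : t ∈ Function.support (φ.normed μ) := ht
    rw [φ.support_normed_eq, mem_ball_zero_iff] at h1
    exact h1.trans_le (min_le_left _ _)
  have hsub : ∀ a ∈ Metric.ball c R, ∀ t, ‖t‖ < R → a - t ∈ K := fun a ha t ht => by
    rw [hK, Metric.mem_closedBall, dist_eq_norm, sub_right_comm]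
    rw [Metric.mem_ball, dist_eq_norm] at ha
    exact (norm_sub_le _ _).trans (by linarith)
  set h : E → ℝ := convolution (φ.normed μ) F (ContinuousLinearMap.lsmul ℝ ℝ) μ with hh
  have hsm : ContDiff ℝ ∞ h := φ.hasCompactSupport_normed.contDiff_convolution_left
    _ (φ.contDiff_normed (n := ⊤)) hFint.locallyIntegrable
  have hex : ∀ a, Integrable (fun t => φ.normed μ t * F (a - t)) μ := fun a =>
    φ.hasCompactSupport_normed.convolutionExists_left (ContinuousLinearMap.lsmul ℝ ℝ)
      φ.continuous_normed hFint.locallyIntegrable a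
  -- Convolution averages translates of f, each with the same Lipschitz constant for N.
  have hlip' : ∀ a ∈ Metric.ball c R, ∀ b ∈ Metric.ball c R, |h b - h a| ≤ L * N (b - a) := by
    intro a ha b hb
    have h1 : h b - h a = ∫ t, φ.normed μ t * (F (b - t) - F (a - t)) ∂μ := by
      simp only [mul_sub]
      exact (integral_sub (hex b) (hex a)).symm
    have h2 : ∫ t, φ.normed μ t * (L * N (b - a)) ∂μ = L * N (b - a) := by
      rw [integral_mul_const, φ.integral_normed, one_mul]
    rw [h1, ← h2]
    refine norm_integral_le_of_norm_le (G := ℝ) ((φ.integrable_normed (μ := μ)).mul_const _)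
      (.of_forall fun t => ?_)
    rw [norm_mul, Real.norm_of_nonneg (φ.nonneg_normed t)]
    by_cases ht : φ.normed μ t = 0
    · simp [ht]
    · refine mul_le_mul_of_nonneg_left ?_ (φ.nonneg_normed t)
      have h3 := hFlip _ (hsub a ha t (hφsupp t ht)) _ (hsub b hb t (hφsupp t ht))
      rwa [sub_sub_sub_cancel_right] at h3
  refine ⟨h, hsm, fun a ha => ?_, fun a ha w => ?_⟩
  · have haK : a ∈ K := by simpa using hsub a ha 0 (by simpa using hR)
    have h1 : F a = f a := Set.indicator_of_mem haK f
    rw [← h1, ← Real.dist_eq]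
    refine φ.dist_normed_convolution_le hFint.aestronglyMeasurable fun x hx => ?_
    have hx' : ‖x - a‖ < ρ := by rwa [Metric.mem_ball, dist_eq_norm] at hx
    have hxK : x ∈ K := by
      have := hsub a ha (a - x) (by rw [norm_sub_rev]; exact hx'.trans_le (min_le_left _ _))
      rwa [sub_sub_cancel] at this
    rw [Real.dist_eq]
    refine (hFlip a haK x hxK).trans ?_
    calc L * N (x - a) ≤ L * (C * ρ) := by gcongr; exact (hN _).trans (by gcongr)
      _ = L * C * ρ := by ring
      _ ≤ (L * C + 1) * (δ / (L * C + 1)) := by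
          gcongr
          · linarith
          · exact min_le_right _ _
      _ = δ := by field_simp
  · exact norm_fderiv_apply_le_of_seminorm hL (Metric.isOpen_ball.mem_nhds ha)
      (hsm.differentiable (by simp) a) (fun b hb => hlip' a ha b hb) w

end Convolution

section LocalSmoothing

variable {E : Type*} [NormedAddCommGroup E] [NormedSpace ℝ E] [FiniteDimensional ℝ E]
  {M : Type*} [EMetricSpace M] [ChartedSpace E M] [IsManifold 𝓘(ℝ, E) ∞ M]
  [Bundle.RiemannianBundle (fun x : M => TangentSpace 𝓘(ℝ, E) x)]
  [IsContMDiffRiemannianBundle 𝓘(ℝ, E) ∞ E (fun x : M => TangentSpace 𝓘(ℝ, E) x)]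
  [IsRiemannianManifold 𝓘(ℝ, E) M]

/-- A Lipschitz function can be smoothed on small open sets that do not depend on the precision,
with a uniform bound on the gradient. -/
theorem LipschitzWith.exists_local_smoothing {r : M → ℝ} (hr : LipschitzWith 1 r) (p : M) :
    ∃ U ∈ nhds p, ∀ δ > 0, ∃ h : M → ℝ, (∀ x ∈ U, ContMDiffAt 𝓘(ℝ, E) 𝓘(ℝ, ℝ) ∞ h x) ∧
      (∀ x ∈ U, |h x - r x| ≤ δ) ∧ ∀ x ∈ U, GradBound E h x 4 := by
  have := IsContMDiffRiemannianBundle.isContinuousRiemannianBundle (E := E) (M := M)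
  obtain ⟨N, C, hC, hNC, h1, h2⟩ := exists_chart_seminorm (E := E) p
  set e := extChartAt 𝓘(ℝ, E) p with he
  obtain ⟨R', hR', hball⟩ := Metric.eventually_nhds_iff_ball.1 h1
  obtain ⟨R, rfl⟩ : ∃ R, R' = 4 * R := ⟨R' / 4, by ring⟩
  have hR : 0 < R := by linarith
  have hlip : ∀ a ∈ Metric.ball (e p) (4 * R), ∀ b ∈ Metric.ball (e p) (4 * R),
      |r (e.symm b) - r (e.symm a)| ≤ 2 * N (b - a) := fun a ha b hb => by
    have h3 := (hr (e.symm b) (e.symm a)).trans_eq (by rw [ENNReal.coe_one, one_mul])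
    rw [edist_comm (e.symm b)] at h3
    have h4 := h3.trans (edist_extChartAt_symm_le (convex_ball _ _) hball ha hb)
    rw [edist_dist, ENNReal.ofReal_le_ofReal_iff (by positivity)] at h4
    exact h4
  refine ⟨{x | (x ∈ e.source ∧ ∀ v : TangentSpace 𝓘(ℝ, E) x,
    N (mfderiv 𝓘(ℝ, E) 𝓘(ℝ, E) e x v) ≤ 2 * ‖v‖) ∧ e x ∈ Metric.ball (e p) R},
    h2.and ((continuousAt_extChartAt p).eventually_mem (Metric.ball_mem_nhds _ hR)),
    fun δ hδ => ?_⟩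
  -- In the chart r has Lipschitz constant 2 for N, and the differential of the chart contributes
  -- another factor 2; hence the gradient bound 4. The set above was fixed before δ, which only
  -- affects the convolution radius.
  obtain ⟨h, hsm, hnear, hgrad⟩ := exists_contDiff_near_of_lipschitz (f := r ∘ e.symm)
    zero_le_two hR hC hNC hlip hδ
  have hes : ∀ x ∈ e.source, ContMDiffAt 𝓘(ℝ, E) 𝓘(ℝ, E) ∞ e x := fun x hx =>
    contMDiffAt_extChartAt' (by rwa [he, extChartAt_source] at hx)
  refine ⟨h ∘ e, ?_, ?_, ?_⟩
  · rintro x ⟨⟨hx, -⟩, -⟩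
    exact ContMDiffAt.comp x hsm.contMDiff.contMDiffAt (hes x hx)
  · rintro x ⟨⟨hx, -⟩, hxR⟩
    have h3 := hnear _ hxR
    rw [Function.comp_apply, e.left_inv hx] at h3
    exact h3
  · rintro x ⟨⟨hx, hv⟩, hxR⟩ v
    have h3 : rdAt E (h ∘ e) x v = fderiv ℝ h (e x) (mfderiv 𝓘(ℝ, E) 𝓘(ℝ, E) e x v) := by
      have h4 := mfderiv_comp x (hsm.contMDiff.mdifferentiable (by simp) (e x))
        ((hes x hx).mdifferentiableAt (by simp))
      rw [mfderiv_eq_fderiv] at h4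
      exact congrArg (fun L : TangentSpace 𝓘(ℝ, E) x →L[ℝ] ℝ => L v) h4
    rw [h3]
    refine (hgrad _ hxR _).trans ?_
    have h5 := hv v
    linarith

end LocalSmoothing

/-! ### Gradient bounds -/

section GradientBounds

variable {E : Type*} [NormedAddCommGroup E] [NormedSpace ℝ E]
  {M : Type*} [TopologicalSpace M] [ChartedSpace E M]
  [Bundle.RiemannianBundle (fun x : M => TangentSpace 𝓘(ℝ, E) x)]
  {f g : M → ℝ} {x : M} {C D : ℝ}

theorem GradBound.mono (h : GradBound E f x C) (hCD : C ≤ D) : GradBound E f x D := fun v =>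
  (h v).trans (mul_le_mul_of_nonneg_right hCD (norm_nonneg v))

theorem GradBound.congr (h : GradBound E f x C) (hfg : g =ᶠ[nhds x] f) : GradBound E g x C := by
  intro v
  have h1 : rdAt E g x = rdAt E f x := hfg.mfderiv_eq
  rw [h1]
  exact h v

theorem gradBound_const (c : ℝ) (x : M) : GradBound E (fun _ => c) x 0 := by
  intro v
  have h1 : rdAt E (fun _ : M => c) x = 0 := mfderiv_const
  rw [h1]
  simp

theorem gradBound_of_notMem_tsupport (hx : x ∉ tsupport f) : GradBound E f x 0 :=
  (gradBound_const 0 x).congr (notMem_tsupport_iff_eventuallyEq.1 hx)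

theorem GradBound.add (hf : MDifferentiableAt 𝓘(ℝ, E) 𝓘(ℝ, ℝ) f x)
    (hg : MDifferentiableAt 𝓘(ℝ, E) 𝓘(ℝ, ℝ) g x) (hC : GradBound E f x C)
    (hD : GradBound E g x D) : GradBound E (fun y => f y + g y) x (C + D) := by
  intro v
  have h1 : rdAt E (fun y => f y + g y) x = rdAt E f x + rdAt E g x := mfderiv_add hf hg
  have h2 : rdAt E (fun y => f y + g y) x v = rdAt E f x v + rdAt E g x v := by
    rw [h1]; rfl
  rw [h2, add_mul]
  exact (abs_add_le _ _).trans (add_le_add (hC v) (hD v))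

theorem GradBound.sum {ι : Type*} (s : Finset ι) {F : ι → M → ℝ} {B : ι → ℝ}
    (hF : ∀ a, ContMDiff 𝓘(ℝ, E) 𝓘(ℝ, ℝ) ∞ (F a)) (hB : ∀ a, GradBound E (F a) x (B a)) :
    GradBound E (fun y => ∑ a ∈ s, F a y) x (∑ a ∈ s, B a) := by
  classical
  induction s using Finset.induction_on with
  | empty => simpa using gradBound_const (E := E) 0 x
  | insert a s ha ih =>
    simp only [Finset.sum_insert ha]
    refine GradBound.add ((hF a).mdifferentiable (by simp) x) ?_ (hB a) ih
    exact (ContMDiff.sum fun a _ => hF a).mdifferentiable (by simp) x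

theorem GradBound.mul (hf : MDifferentiableAt 𝓘(ℝ, E) 𝓘(ℝ, ℝ) f x)
    (hg : MDifferentiableAt 𝓘(ℝ, E) 𝓘(ℝ, ℝ) g x) (hC : GradBound E f x C)
    (hD : GradBound E g x D) : GradBound E (fun y => f y * g y) x (|f x| * D + |g x| * C) := by
  intro v
  have h1 : rdAt E (fun y => f y * g y) x = f x • rdAt E g x + g x • rdAt E f x :=
    (hf.hasMFDerivAt.mul hg.hasMFDerivAt).mfderiv
  have h2 : rdAt E (fun y => f y * g y) x v = f x * rdAt E g x v + g x * rdAt E f x v := by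
    rw [h1]; rfl
  rw [h2, add_mul, mul_assoc, mul_assoc]
  refine (abs_add_le _ _).trans ?_
  rw [abs_mul, abs_mul]
  gcongr
  · exact hD v
  · exact hC v

variable [IsManifold 𝓘(ℝ, E) ∞ M]
  [IsContinuousRiemannianBundle E (fun x : M => TangentSpace 𝓘(ℝ, E) x)]

theorem exists_eventually_gradBound {k : M → ℝ} (hk : ContMDiff 𝓘(ℝ, E) 𝓘(ℝ, ℝ) ∞ k) (p : M) :
    ∃ D, 0 ≤ D ∧ ∀ᶠ y in nhds p, GradBound E k y D := by
  have : IsManifold 𝓘(ℝ, E) 1 M := IsManifold.of_le (n := ∞) (by exact_mod_cast le_top)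
  set e := extChartAt 𝓘(ℝ, E) p with he
  obtain ⟨C, hC, hC'⟩ := eventually_norm_trivializationAt_lt E
    (fun x : M => TangentSpace 𝓘(ℝ, E) x) p
  have hsm : ContDiffOn ℝ ∞ (k ∘ e.symm) e.target := by
    rw [← contMDiffOn_iff_contDiffOn]
    exact hk.comp_contMDiffOn (contMDiffOn_extChartAt_symm p)
  have ht : e.target ∈ nhds (e p) := extChartAt_target_mem_nhds p
  have hcont : ContinuousAt (fderiv ℝ (k ∘ e.symm)) (e p) :=
    ((hsm.contDiffAt ht).fderiv_right (m := 0) (by simp)).continuousAt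
  have hlt : ∀ᶠ y in nhds p, ‖fderiv ℝ (k ∘ e.symm) (e y)‖ < ‖fderiv ℝ (k ∘ e.symm) (e p)‖ + 1 :=
    (hcont.comp (continuousAt_extChartAt p)).norm.eventually_lt_const (lt_add_one _)
  refine ⟨(‖fderiv ℝ (k ∘ e.symm) (e p)‖ + 1) * C, by positivity, ?_⟩
  filter_upwards [hC', hlt, extChartAt_source_mem_nhds (I := 𝓘(ℝ, E)) p] with y hy hy' hys
  intro v
  have hy2 : y ∈ (chartAt E p).source := by rwa [extChartAt_source] at hys
  have h2 := TangentBundle.continuousLinearMapAt_trivializationAt (I := 𝓘(ℝ, E)) hy2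
  have h3 : ((trivializationAt E (fun x : M => TangentSpace 𝓘(ℝ, E) x) p).continuousLinearMapAt ℝ y
      v : E) = mfderiv 𝓘(ℝ, E) 𝓘(ℝ, E) e y v :=
    congrArg (fun L : TangentSpace 𝓘(ℝ, E) y →L[ℝ] E => L v) h2
  have h4 := ContinuousLinearMap.le_of_opNorm_le _ hy.le v
  have h5 : rdAt E k y v = fderiv ℝ (k ∘ e.symm) (e y) (mfderiv 𝓘(ℝ, E) 𝓘(ℝ, E) e y v) := by
    have h6 : rdAt E k y = rdAt E ((k ∘ e.symm) ∘ e) y := by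
      refine Filter.EventuallyEq.mfderiv_eq ?_
      filter_upwards [(isOpen_extChartAt_source (I := 𝓘(ℝ, E)) p).mem_nhds hys] with z hz
      rw [Function.comp_apply, Function.comp_apply, e.left_inv hz]
    have h7 := mfderiv_comp y
      (((hsm.contDiffAt ((isOpen_extChartAt_target p).mem_nhds (e.map_source hys))).contMDiffAt
        (n := ∞)).mdifferentiableAt (by simp))
      ((contMDiffAt_extChartAt' (n := ∞) hy2).mdifferentiableAt (by simp))
    rw [mfderiv_eq_fderiv] at h7
    rw [h6]
    exact congrArg (fun L : TangentSpace 𝓘(ℝ, E) y →L[ℝ] ℝ => L v) h7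
  rw [h5]
  refine (ContinuousLinearMap.le_opNorm (fderiv ℝ (k ∘ e.symm) (e y)) _).trans ?_
  rw [mul_assoc]
  refine mul_le_mul hy'.le ((congrArg norm h3).symm.le.trans h4) (norm_nonneg (E := E) _)
    (by positivity)

theorem exists_gradBound_of_hasCompactSupport {k : M → ℝ}
    (hk : ContMDiff 𝓘(ℝ, E) 𝓘(ℝ, ℝ) ∞ k) (hkc : HasCompactSupport k) :
    ∃ D, 0 ≤ D ∧ ∀ x, GradBound E k x D := by
  obtain ⟨D, hD, h⟩ : ∃ D, 0 ≤ D ∧ ∀ x ∈ tsupport k, GradBound E k x D := by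
    refine IsCompact.induction_on (p := fun s => ∃ D, 0 ≤ D ∧ ∀ x ∈ s, GradBound E k x D) hkc
      ⟨0, le_rfl, by simp⟩ (fun s t hst ⟨D, hD, h⟩ => ⟨D, hD, fun x hx => h x (hst hx)⟩) ?_ ?_
    · rintro s t ⟨C, hC, h⟩ ⟨D, hD, h'⟩
      refine ⟨max C D, hC.trans (le_max_left _ _), ?_⟩
      rintro x (hx | hx)
      · exact (h x hx).mono (le_max_left _ _)
      · exact (h' x hx).mono (le_max_right _ _)
    · intro x _
      obtain ⟨D, hD, h⟩ := exists_eventually_gradBound hk x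
      exact ⟨{y | GradBound E k y D}, mem_nhdsWithin_of_mem_nhds h, D, hD, fun y hy => hy⟩
  refine ⟨D, hD, fun x => ?_⟩
  by_cases hx : x ∈ tsupport k
  · exact h x hx
  · exact (gradBound_of_notMem_tsupport hx).mono hD

end GradientBounds

/-! ### Invariant partitions of unity -/

section Partition

open MeasureTheory

theorem exists_smul_mem_tsupport_of_orbitAverage_ne_zero {G M : Type*} [Group G]
    [MeasurableSpace G] (μ : Measure G) [TopologicalSpace M] [MulAction G M] {k : M → ℝ} {x : M}
    (h : orbitAverage μ k x ≠ 0) : ∃ g : G, g • x ∈ tsupport k := by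
  by_contra! h1
  refine h ?_
  have h2 : ∀ g : G, k (g⁻¹ • x) = 0 := fun g => image_eq_zero_of_notMem_tsupport (h1 g⁻¹)
  simp [orbitAverage, h2]

universe u

/-- The projection to `M/G` is open, so images of supports of bumps centred at a representative form
neighbourhood bases. A locally finite cover of the locally compact, σ-compact quotient by such
images pulls back to saturated sets in `M`. -/
theorem exists_locallyFinite_bumps {G : Type*} [TopologicalSpace G] [Group G]
    (E : Type*) [NormedAddCommGroup E] [NormedSpace ℝ E] [FiniteDimensional ℝ E]
    {M : Type u} [TopologicalSpace M] [T2Space M] [LocallyCompactSpace M] [ChartedSpace E M]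
    [MulAction G M] [ProperSMul G M] [T2Space (MulAction.orbitRel.Quotient G M)]
    [SigmaCompactSpace (MulAction.orbitRel.Quotient G M)] {U : M → Set M}
    (hU : ∀ p, U p ∈ nhds p) :
    ∃ (ι : Type u) (_ : Countable ι) (p : ι → M) (b : ∀ a, SmoothBumpFunction 𝓘(ℝ, E) (p a)),
      (∀ a, tsupport (b a) ⊆ U (p a)) ∧ (∀ x, ∃ (a : ι) (g : G), b a (g • x) ≠ 0) ∧
      LocallyFinite fun a => {x | ∃ g : G, g • x ∈ tsupport (b a)} := by
  have hopen : IsOpenQuotientMap (Quotient.mk (MulAction.orbitRel G M)) :=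
    MulAction.isOpenQuotientMap_quotientMk
  have : WeaklyLocallyCompactSpace (MulAction.orbitRel.Quotient G M) :=
    hopen.weaklyLocallyCompactSpace
  have hbasis : ∀ q : MulAction.orbitRel.Quotient G M, (nhds q).HasBasis
      (fun f : SmoothBumpFunction 𝓘(ℝ, E) q.out => tsupport f ⊆ U q.out)
      fun f => Quotient.mk (MulAction.orbitRel G M) '' Function.support f := fun q => by
    have h1 := (SmoothBumpFunction.nhds_basis_support (I := 𝓘(ℝ, E)) (hU q.out)).map
      (Quotient.mk (MulAction.orbitRel G M))
    rwa [hopen.isOpenMap.map_nhds_eq hopen.continuous.continuousAt, Quotient.out_eq] at h1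
  obtain ⟨ι, c, b, hb, hcov, hlf⟩ := refinement_of_locallyCompact_sigmaCompact_of_nhds_basis hbasis
  have hne : ∀ a, (Quotient.mk (MulAction.orbitRel G M) '' Function.support (b a)).Nonempty :=
    fun a => (b a).nonempty_support.image _
  refine ⟨ι, Set.countable_univ_iff.1 (hlf.countable_univ hne), fun a => (c a).out, b, hb,
    fun x => ?_, ?_⟩
  · obtain ⟨a, y, hy, hyx⟩ : ∃ a, Quotient.mk (MulAction.orbitRel G M) x ∈
        Quotient.mk (MulAction.orbitRel G M) '' Function.support (b a) := by
      have := hcov.ge (Set.mem_univ (Quotient.mk (MulAction.orbitRel G M) x))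
      exact Set.mem_iUnion.1 this
    obtain ⟨g, hg⟩ := Quotient.exact hyx
    exact ⟨a, g, by rw [show g • x = y from hg]; exact hy⟩
  · refine (hlf.closure.preimage_continuous hopen.continuous).subset ?_
    rintro a x ⟨g, hg⟩
    have h1 : Quotient.mk (MulAction.orbitRel G M) (g • x) = Quotient.mk _ x :=
      Quotient.sound ⟨g, rfl⟩
    rw [Set.mem_preimage, ← h1]
    exact image_closure_subset_closure_image hopen.continuous ⟨_, hg, rfl⟩

variable {G : Type*} [TopologicalSpace G] [Group G] [IsTopologicalGroup G]
  [MeasurableSpace G] [BorelSpace G] (μ : Measure G) [IsFiniteMeasureOnCompacts μ]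
  [μ.IsMulLeftInvariant] [μ.IsOpenPosMeasure]
  (EG : Type*) [NormedAddCommGroup EG] [NormedSpace ℝ EG] [ChartedSpace EG G]
  [LieGroup 𝓘(ℝ, EG) ∞ G]
  {E : Type*} [NormedAddCommGroup E] [NormedSpace ℝ E] [FiniteDimensional ℝ E]
  {M : Type u} [TopologicalSpace M] [T2Space M] [LocallyCompactSpace M]
  [ChartedSpace E M] [IsManifold 𝓘(ℝ, E) ∞ M]
  [MulAction G M] [ProperSMul G M] [ContMDiffSMul 𝓘(ℝ, EG) 𝓘(ℝ, E) ∞ G M]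

include EG in
-- Divide the bumps by the sum S of their averages, which is smooth, positive and invariant;
-- invariance lets 1/S pass through the averaging. The functions χ stay compactly supported, and it
-- is their averages that sum to 1.
theorem exists_averaged_partition [T2Space (MulAction.orbitRel.Quotient G M)]
    [SigmaCompactSpace (MulAction.orbitRel.Quotient G M)] {U : M → Set M}
    (hU : ∀ p, U p ∈ nhds p) :
    ∃ (ι : Type u) (_ : Countable ι) (p : ι → M) (χ : ι → M → ℝ),
      (∀ a, ContMDiff 𝓘(ℝ, E) 𝓘(ℝ, ℝ) ∞ (χ a)) ∧ (∀ a, HasCompactSupport (χ a)) ∧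
      (∀ a, tsupport (χ a) ⊆ U (p a)) ∧ (∀ a x, 0 ≤ χ a x) ∧
      (LocallyFinite fun a => {x | ∃ g : G, g • x ∈ tsupport (χ a)}) ∧
      ∀ x, ∑ᶠ a, orbitAverage μ (χ a) x = 1 := by
  obtain ⟨ι, hι, p, b, hbU, hcov, hlf⟩ := exists_locallyFinite_bumps (G := G) E hU
  have hbs : ∀ a, ContMDiff 𝓘(ℝ, E) 𝓘(ℝ, ℝ) ∞ (b a) := fun a => (b a).contMDiff
  have hbc : ∀ a, HasCompactSupport (b a) := fun a => (b a).hasCompactSupport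
  have hlf' : LocallyFinite fun a => Function.support (orbitAverage μ (b a)) :=
    hlf.subset fun a x hx => exists_smul_mem_tsupport_of_orbitAverage_ne_zero μ hx
  let S : M → ℝ := fun x => ∑ᶠ a, orbitAverage μ (b a) x
  have hnn : ∀ a x, 0 ≤ orbitAverage μ (b a) x := fun a x =>
    integral_nonneg fun g => (b a).nonneg
  have hSs : ContMDiff 𝓘(ℝ, E) 𝓘(ℝ, ℝ) ∞ S :=
    contMDiff_finsum (fun a => contMDiff_orbitAverage μ EG (hbs a) (hbc a)) hlf'
  have hSpos : ∀ x, 0 < S x := fun x => by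
    obtain ⟨a, g, hg⟩ := hcov x
    refine finsum_pos (hnn · x) ⟨a, ?_⟩ (hlf'.point_finite x)
    refine Continuous.integral_pos_of_hasCompactSupport_nonneg_nonzero (x := g⁻¹)
      ?_ (hasCompactSupport_inv_smul (hbc a) x) (fun g => (b a).nonneg) (by simpa using hg)
    have := (hbs a).continuous
    fun_prop
  have hSinv : ∀ (g : G) x, S (g • x) = S x := fun g x =>
    finsum_congr fun a => orbitAverage_smul μ _ g x
  have hts : ∀ a, tsupport (fun x => (S x)⁻¹ * b a x) ⊆ tsupport (b a) := fun a =>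
    closure_mono fun x hx h => hx (by simp [h])
  have hav : ∀ a x, orbitAverage μ (fun x => (S x)⁻¹ * b a x) x =
      (S x)⁻¹ * orbitAverage μ (b a) x := fun a x => by
    simp only [orbitAverage, hSinv, integral_const_mul]
  refine ⟨ι, hι, p, fun a x => (S x)⁻¹ * b a x, fun a => ?_, fun a => (hbc a).mono' ?_,
    fun a => (hts a).trans (hbU a), fun a x => mul_nonneg (inv_nonneg.2 (hSpos x).le) (b a).nonneg,
    hlf.subset fun a x ⟨g, hg⟩ => ⟨g, hts a hg⟩, fun x => ?_⟩
  · exact (hSs.inv₀ fun x => (hSpos x).ne').mul (hbs a)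
  · exact subset_closure.trans (hts a)
  · simp only [hav]
    rw [← mul_finsum]
    exact inv_mul_cancel₀ (hSpos x).ne'

end Partition

/-! ### Invariant smoothing of invariant Lipschitz functions -/

section InvariantSmoothing

open MeasureTheory

variable {G : Type*} [TopologicalSpace G] [Group G] [IsTopologicalGroup G]
  [MeasurableSpace G] [BorelSpace G] (μ : Measure G) [IsFiniteMeasureOnCompacts μ]
  [μ.IsMulLeftInvariant] [μ.IsOpenPosMeasure]
  (EG : Type*) [NormedAddCommGroup EG] [NormedSpace ℝ EG] [ChartedSpace EG G]
  [LieGroup 𝓘(ℝ, EG) ∞ G]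
  {E : Type*} [NormedAddCommGroup E] [NormedSpace ℝ E] [FiniteDimensional ℝ E]
  {M : Type*} [EMetricSpace M] [LocallyCompactSpace M]
  [ChartedSpace E M] [IsManifold 𝓘(ℝ, E) ∞ M]
  [Bundle.RiemannianBundle (fun x : M => TangentSpace 𝓘(ℝ, E) x)]
  [IsContMDiffRiemannianBundle 𝓘(ℝ, E) ∞ E (fun x : M => TangentSpace 𝓘(ℝ, E) x)]
  [IsRiemannianManifold 𝓘(ℝ, E) M]
  [MulAction G M] [ProperSMul G M] [ContMDiffSMul 𝓘(ℝ, EG) 𝓘(ℝ, E) ∞ G M]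

include μ EG in
/-- An invariant Lipschitz function is at bounded distance from a smooth invariant function with
bounded gradient. -/
theorem exists_smooth_invariant_near [T2Space (MulAction.orbitRel.Quotient G M)]
    [SigmaCompactSpace (MulAction.orbitRel.Quotient G M)]
    (hisom : ∀ (g : G) (x : M) (v : TangentSpace 𝓘(ℝ, E) x),
      ‖mfderiv 𝓘(ℝ, E) 𝓘(ℝ, E) (fun y : M => g • y) x v‖ = ‖v‖)
    {r : M → ℝ} (hr : LipschitzWith 1 r) (hinv : ∀ (g : G) x, r (g • x) = r x) :
    ∃ f : M → ℝ, ContMDiff 𝓘(ℝ, E) 𝓘(ℝ, ℝ) ∞ f ∧ (∀ (g : G) x, f (g • x) = f x) ∧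
      (∀ x, |f x - r x| ≤ 1) ∧ ∀ x, GradBound E f x 5 := by
  have : IsManifold 𝓘(ℝ, E) 1 M := IsManifold.of_le (n := ∞) (by exact_mod_cast le_top)
  have := IsContMDiffRiemannianBundle.isContinuousRiemannianBundle (E := E) (M := M)
  choose U hU hsmooth using fun p => hr.exists_local_smoothing (E := E) p
  obtain ⟨ι, hι, p, χ, hχs, hχc, hχU, hχ0, hlf, hsum⟩ :=
    exists_averaged_partition (G := G) μ EG (E := E) hU
  choose D hD0 hD using fun a => exists_gradBound_of_hasCompactSupport (hχs a) (hχc a)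
  choose m hm0 hm using fun a => exists_measure_inv_smul_mem_le (G := G) μ (hχc a)
  have := Encodable.ofCountable ι
  obtain ⟨η, hη, s, hηs, hs⟩ := posSumOfEncodable one_pos ι
  -- The local precision beats both the gradient bound D of χ and the measure m of group elements
  -- that matter, so that δDm ≤ η with the η summing to at most 1.
  let δ : ι → ℝ := fun a => min 1 (η a / (D a * m a + 1))
  have hDm : ∀ a, 0 ≤ D a * m a := fun a => mul_nonneg (hD0 a) (hm0 a)
  have hδ : ∀ a, 0 < δ a := fun a =>
    lt_min one_pos (div_pos (hη a) (by linarith [hDm a]))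
  have hδη : ∀ a, δ a * D a * m a ≤ η a := fun a => by
    have h1 : δ a * (D a * m a + 1) ≤ η a :=
      (le_div_iff₀ (by linarith [hDm a])).1 (min_le_right _ _)
    nlinarith [hδ a]
  choose h hhs hhr hhg using fun a => hsmooth (p a) (δ a) (hδ a)
  have hF : ∀ (c : ℝ) a, ContMDiff 𝓘(ℝ, E) 𝓘(ℝ, ℝ) ∞ fun x => χ a x * (h a x - c) :=
    fun c a => contMDiff_of_tsupport fun x hx => (hχs a x).mul
      ((hhs a x (hχU a (tsupport_mul_subset_left hx))).sub contMDiffAt_const)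
  have hFc : ∀ (c : ℝ) a, HasCompactSupport fun x => χ a x * (h a x - c) :=
    fun c a => (hχc a).mul_right
  have hF0 : ∀ a, (fun x => χ a x * h a x) = fun x => χ a x * (h a x - 0) := fun a => by simp
  have hshift : ∀ c a x, orbitAverage μ (fun x => χ a x * h a x) x =
      orbitAverage μ (fun x => χ a x * (h a x - c)) x + c * orbitAverage μ (χ a) x :=
    fun c a x => by
      simp only [orbitAverage]
      rw [← integral_const_mul, ← integral_add
        (integrable_inv_smul μ (hF c a).continuous (hFc c a) x)
        ((integrable_inv_smul μ (hχs a).continuous (hχc a) x).const_mul c)]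
      exact integral_congr_ae (.of_forall fun g => by ring)
  have hsupp : ∀ c a x, orbitAverage μ (fun x => χ a x * (h a x - c)) x ≠ 0 →
      ∃ g : G, g • x ∈ tsupport (χ a) := fun c a x hx => by
    obtain ⟨g, hg⟩ := exists_smul_mem_tsupport_of_orbitAverage_ne_zero μ hx
    exact ⟨g, tsupport_mul_subset_left hg⟩
  let f : M → ℝ := fun x => ∑ᶠ a, orbitAverage μ (fun x => χ a x * h a x) x
  have hfs : ContMDiff 𝓘(ℝ, E) 𝓘(ℝ, ℝ) ∞ f := by
    refine contMDiff_finsum (fun a => ?_) (hlf.subset fun a x hx => hsupp 0 a x ?_)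
    · rw [hF0]
      exact contMDiff_orbitAverage μ EG (hF 0 a) (hFc 0 a)
    · rwa [← hF0]
  -- Since the averages of χ sum to 1, any constant c may be subtracted from all the local
  -- smoothings and added back outside. Below, c = r(x).
  have hrep : ∀ x, ∃ s : Finset ι, (∀ c, ∀ᶠ y in nhds x,
      f y = ∑ a ∈ s, orbitAverage μ (fun x => χ a x * (h a x - c)) y + c) ∧
      ∑ a ∈ s, orbitAverage μ (χ a) x = 1 := fun x => by
    obtain ⟨N, hN, hfin⟩ := hlf x
    have h1 : ∀ y ∈ N, ∑ a ∈ hfin.toFinset, orbitAverage μ (χ a) y = 1 := fun y hy => by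
      rw [← hsum y]
      refine (finsum_eq_sum_of_support_subset _ fun a ha => ?_).symm
      rw [Set.Finite.coe_toFinset]
      exact ⟨y, exists_smul_mem_tsupport_of_orbitAverage_ne_zero μ ha, hy⟩
    refine ⟨hfin.toFinset, fun c => ?_, h1 x (mem_of_mem_nhds hN)⟩
    filter_upwards [hN] with y hy
    have h2 : f y = ∑ a ∈ hfin.toFinset, orbitAverage μ (fun x => χ a x * h a x) y := by
      refine finsum_eq_sum_of_support_subset _ fun a ha => ?_
      rw [Set.Finite.coe_toFinset]
      exact ⟨y, hsupp 0 a y (by rwa [← hF0]), hy⟩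
    rw [h2, Finset.sum_congr rfl fun a _ => hshift c a y, Finset.sum_add_distrib,
      ← Finset.mul_sum, h1 y hy, mul_one]
  refine ⟨f, hfs, fun g x => finsum_congr fun a => orbitAverage_smul μ _ g x, fun x => ?_,
    fun x => ?_⟩
  · obtain ⟨s, h1, h2⟩ := hrep x
    rw [(h1 (r x)).self_of_nhds, add_sub_cancel_right, ← h2]
    refine (Finset.abs_sum_le_sum_abs _ _).trans (Finset.sum_le_sum fun a _ => ?_)
    refine norm_integral_le_of_norm_le (G := ℝ)
      (integrable_inv_smul μ (hχs a).continuous (hχc a) x) (.of_forall fun g => ?_)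
    by_cases hg : g⁻¹ • x ∈ tsupport (χ a)
    · have h3 := hhr a _ (hχU a hg)
      rw [hinv] at h3
      rw [Real.norm_eq_abs, abs_mul, abs_of_nonneg (hχ0 a _)]
      exact mul_le_of_le_one_right (hχ0 a _) (h3.trans (min_le_left _ _))
    · simp [image_eq_zero_of_notMem_tsupport hg]
  · obtain ⟨t, h1, h2⟩ := hrep x
    -- By the product rule the term χ · dh gives 4χ, and (h - r(x)) · dχ gives at most δD, because
    -- r(g⁻¹x) = r(x). Integration yields 4 times the average of χ plus η; summing over the indices
    -- gives 4 + 1 = 5.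
    have hgrad : ∀ a, GradBound E (orbitAverage μ fun y => χ a y * (h a y - r x)) x
        (4 * orbitAverage μ (χ a) x + η a) := fun a => by
      obtain ⟨A, hAm, hA, hAfin, hAle⟩ := hm a x
      have hint1 := integrable_inv_smul μ (hχs a).continuous (hχc a) x
      have hint2 : Integrable (A.indicator fun _ => δ a * D a) μ :=
        (integrable_indicator_iff hAm).2 (integrableOn_const hAfin)
      have hδD : 0 ≤ δ a * D a := mul_nonneg (hδ a).le (hD0 a)
      have hind : ∀ g, 0 ≤ A.indicator (fun _ => δ a * D a) g := fun g =>
        Set.indicator_nonneg (fun _ _ => hδD) g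
      refine (gradBound_orbitAverage μ EG (hF (r x) a) (hFc (r x) a) hisom
        (B := fun g => 4 * χ a (g⁻¹ • x) + A.indicator (fun _ => δ a * D a) g)
        (fun g => add_nonneg (mul_nonneg (by norm_num) (hχ0 a _)) (hind g)) (fun g => ?_)
        ((hint1.const_mul 4).add hint2)).mono ?_
      · by_cases hg : g⁻¹ • x ∈ tsupport (χ a)
        · have hU := hχU a hg
          have h3 := hhr a _ hU
          rw [hinv] at h3
          have h4 : GradBound E (fun y => h a y - r x) (g⁻¹ • x) 4 := by
            simpa [sub_eq_add_neg] using GradBound.add ((hhs a _ hU).mdifferentiableAt (by simp))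
              (contMDiffAt_const.mdifferentiableAt one_ne_zero) (hhg a _ hU)
              (gradBound_const (E := E) (-r x) _)
          refine (GradBound.mul ((hχs a).mdifferentiable (by simp) _)
            (((hhs a _ hU).sub contMDiffAt_const).mdifferentiableAt (by simp))
            (hD a _) h4).mono ?_
          rw [abs_of_nonneg (hχ0 a _), Set.indicator_of_mem (hA g hg), mul_comm]
          gcongr
          exact hD0 a
        · exact (gradBound_of_notMem_tsupport fun h => hg (tsupport_mul_subset_left h)).mono
            (add_nonneg (mul_nonneg (by norm_num) (hχ0 a _)) (hind g))
      · rw [integral_add (hint1.const_mul 4) hint2, integral_const_mul,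
          integral_indicator_const _ hAm, smul_eq_mul]
        refine add_le_add le_rfl ?_
        nlinarith [hδη a]
    have h3 : GradBound E (fun y => ∑ a ∈ t, orbitAverage μ (fun y => χ a y * (h a y - r x)) y +
        r x) x (∑ a ∈ t, (4 * orbitAverage μ (χ a) x + η a) + 0) := by
      have hs : ∀ a, ContMDiff 𝓘(ℝ, E) 𝓘(ℝ, ℝ) ∞
          (orbitAverage μ fun y => χ a y * (h a y - r x)) := fun a =>
        contMDiff_orbitAverage μ EG (hF (r x) a) (hFc (r x) a)
      exact GradBound.add ((ContMDiff.sum fun a _ => hs a).mdifferentiable (by simp) x)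
        (contMDiffAt_const.mdifferentiableAt one_ne_zero) (GradBound.sum t hs hgrad)
        (gradBound_const _ _)
    refine (h3.congr (h1 (r x))).mono ?_
    rw [Finset.sum_add_distrib, ← Finset.mul_sum, h2]
    have h4 := sum_le_hasSum t (fun a _ => (hη a).le) hηs
    linarith

end InvariantSmoothing

/-! ### Slowly oscillating unitaries -/

namespace HigsonCorona

/-- The function `s ↦ exp (i t log (1 + s²))`. -/
def slowChar (t s : ℝ) : ℂ := Complex.exp ((t * Real.log (1 + s ^ 2) : ℝ) * Complex.I)

theorem contDiff_slowChar (t : ℝ) : ContDiff ℝ ∞ (slowChar t) := by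
  have h1 : ContDiff ℝ ∞ fun s : ℝ => t * Real.log (1 + s ^ 2) :=
    contDiff_const.mul (ContDiff.log (by fun_prop) fun s => by positivity)
  exact Complex.contDiff_exp.comp ((Complex.ofRealCLM.contDiff.comp h1).mul contDiff_const)

theorem norm_slowChar (t s : ℝ) : ‖slowChar t s‖ = 1 := Complex.norm_exp_ofReal_mul_I _

theorem slowChar_mul_neg (t s : ℝ) : slowChar t s * slowChar (-t) s = 1 := by
  rw [slowChar, slowChar, ← Complex.exp_add]
  simp

theorem norm_deriv_slowChar (t s : ℝ) : ‖deriv (slowChar t) s‖ = |t| * (2 * |s| / (1 + s ^ 2)) := by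
  have h0 : (1 + s ^ 2 : ℝ) ≠ 0 := by positivity
  have h1 : HasDerivAt (fun s : ℝ => t * Real.log (1 + s ^ 2)) (t * (2 * s / (1 + s ^ 2))) s := by
    have := (((hasDerivAt_pow 2 s).const_add 1).log h0).const_mul t
    simpa using this
  have h2 : HasDerivAt (slowChar t)
      (slowChar t s * (((t * (2 * s / (1 + s ^ 2)) : ℝ) : ℂ) * Complex.I)) s :=
    (h1.ofReal_comp.mul_const Complex.I).cexp
  have h3 : (0 : ℝ) ≤ 1 + s ^ 2 := by positivity
  rw [h2.deriv, norm_mul, norm_slowChar, norm_mul, Complex.norm_I, Complex.norm_real, mul_one,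
    one_mul, Real.norm_eq_abs, abs_mul, abs_div, abs_mul, abs_two, abs_of_nonneg h3]

section

variable {E : Type*} [NormedAddCommGroup E] [NormedSpace ℝ E]
  {M : Type*} [TopologicalSpace M] [ChartedSpace E M]
  [Bundle.RiemannianBundle (fun x : M => TangentSpace 𝓘(ℝ, E) x)]

theorem dNorm_comp_le {F : ℝ → ℂ} {f : M → ℝ} {x : M} {C : ℝ} (hC : 0 ≤ C)
    (hF : DifferentiableAt ℝ F (f x)) (hf : MDifferentiableAt 𝓘(ℝ, E) 𝓘(ℝ, ℝ) f x)
    (h : GradBound E f x C) : dNorm E (fun y => F (f y)) x ≤ ‖deriv F (f x)‖ * C := by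
  refine dNorm_le E (mul_nonneg (norm_nonneg _) hC) fun v => ?_
  have h1 : dAt E (fun y => F (f y)) x v = fderiv ℝ F (f x) (rdAt E f x v) :=
    congrArg (fun L : TangentSpace 𝓘(ℝ, E) x →L[ℝ] ℂ => L v)
      ((hF.hasFDerivAt.hasMFDerivAt.comp x hf.hasMFDerivAt).mfderiv)
  have h2 : fderiv ℝ F (f x) (rdAt E f x v) = (rdAt E f x v) • deriv F (f x) :=
    fderiv_eq_smul_deriv _
  rw [h1, h2, norm_smul, Real.norm_eq_abs, mul_comm, mul_assoc]
  exact mul_le_mul_of_nonneg_left (h v) (norm_nonneg _)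

variable {G : Type*} [Group G] [MulAction G M]

/-- The function `exp (i t log (1 + f²))` as a bounded continuous function. -/
def slowUnitary {f : M → ℝ} (hf : Continuous f) (t : ℝ) : M →ᵇ ℂ :=
  BoundedContinuousFunction.ofNormedAddCommGroup (fun x => slowChar t (f x))
    ((contDiff_slowChar t).continuous.comp hf) 1 fun x => (norm_slowChar t (f x)).le

theorem slowUnitary_mul_neg {f : M → ℝ} (hf : Continuous f) (t : ℝ) :
    slowUnitary hf t * slowUnitary hf (-t) = 1 := by
  ext x
  exact slowChar_mul_neg t (f x)

theorem slowUnitary_mem_smoothHigson {f : M → ℝ} {C : ℝ} (hC : 0 ≤ C)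
    (hf : ContMDiff 𝓘(ℝ, E) 𝓘(ℝ, ℝ) ∞ f) (hinv : ∀ (g : G) x, f (g • x) = f x)
    (hprop : ∀ L, ∃ K : Set M, IsCocompact G K ∧ ∀ x ∉ K, L < |f x|)
    (hgrad : ∀ x, GradBound E f x C) (t : ℝ) :
    slowUnitary hf.continuous t ∈ smoothHigson E M G := by
  refine ⟨fun g x => ?_, (contDiff_slowChar t).contMDiff.comp hf, fun ε hε => ?_⟩
  · exact congrArg (slowChar t) (hinv g x)
  -- For |f| above this threshold, 2|t|C|f| < εf² < ε(1 + f²), which is the required bound on the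
  -- differential.
  · obtain ⟨K, hK, hL⟩ := hprop (|t| * (2 * C) / ε)
    refine ⟨K, hK, fun x hx => ?_⟩
    refine (dNorm_comp_le hC ((contDiff_slowChar t).differentiable (by simp) _)
      (hf.mdifferentiable (by simp) x) (hgrad x)).trans_lt ?_
    have h1 := (div_lt_iff₀ hε).1 (hL x hx)
    rw [norm_deriv_slowChar, mul_div_assoc', div_mul_eq_mul_div, div_lt_iff₀ (by positivity),
      ← sq_abs (f x)]
    nlinarith [abs_nonneg (f x)]

theorem exists_units_of_gradBound {f : M → ℝ} {C : ℝ} (hC : 0 ≤ C)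
    (hf : ContMDiff 𝓘(ℝ, E) 𝓘(ℝ, ℝ) ∞ f) (hinv : ∀ (g : G) x, f (g • x) = f x)
    (hprop : ∀ L, ∃ K : Set M, IsCocompact G K ∧ ∀ x ∉ K, L < |f x|)
    (hgrad : ∀ x, GradBound E f x C) :
    ∃ u : ℝ → (Cg E M G)ˣ, ∀ t x, ((u t : Cg E M G) : M →ᵇ ℂ) x =
      Complex.exp ((t * Real.log (1 + f x ^ 2) : ℝ) * Complex.I) := by
  let w : ℝ → Cg E M G := fun t => ⟨slowUnitary hf.continuous t,
    StarSubalgebra.le_topologicalClosure _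
      (slowUnitary_mem_smoothHigson hC hf hinv hprop hgrad t)⟩
  have hw : ∀ t, w t * w (-t) = 1 := fun t => Subtype.ext (slowUnitary_mul_neg hf.continuous t)
  exact ⟨fun t => ⟨w t, w (-t), hw t, by rw [mul_comm, hw]⟩, fun t x => rfl⟩

end

end HigsonCorona

/-! ### The main theorem -/

theorem mainTheorem8
    {EG : Type*} [NormedAddCommGroup EG] [NormedSpace ℝ EG] [FiniteDimensional ℝ EG]
    {G : Type*} [TopologicalSpace G] [ChartedSpace EG G] [Group G] [LieGroup 𝓘(ℝ, EG) ∞ G]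
    {E : Type*} [NormedAddCommGroup E] [NormedSpace ℝ E] [FiniteDimensional ℝ E]
    {M : Type*} [EMetricSpace M] [ChartedSpace E M] [IsManifold 𝓘(ℝ, E) ∞ M]
    [Bundle.RiemannianBundle (fun x : M => TangentSpace 𝓘(ℝ, E) x)]
    [IsContMDiffRiemannianBundle 𝓘(ℝ, E) ∞ E (fun x : M => TangentSpace 𝓘(ℝ, E) x)]
    [IsRiemannianManifold 𝓘(ℝ, E) M] [CompleteSpace M]
    [MulAction G M] [ContMDiffSMul 𝓘(ℝ, EG) 𝓘(ℝ, E) ∞ G M] [ProperSMul G M]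
    (hisom : ∀ (g : G) (x : M) (v : TangentSpace 𝓘(ℝ, E) x),
      ‖mfderiv 𝓘(ℝ, E) 𝓘(ℝ, E) (fun y : M => g • y) x v‖ = ‖v‖)
    (hconn : ConnectedSpace (MulAction.orbitRel.Quotient G M))
    (hnoncpt : NoncompactSpace (MulAction.orbitRel.Quotient G M)) :
    Uncountable (KTheory.KSpace (HigsonCorona.Corona E M G)) ∧
      Uncountable (KTheory.K1 (HigsonCorona.CoronaAlgebra E M G)) ∧
      Uncountable (KTheory.K1 (HigsonCorona.Cg E M G)) := by
  have : IsManifold 𝓘(ℝ, E) 1 M := IsManifold.of_le (n := ∞) (by exact_mod_cast le_top)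
  have : IsTopologicalGroup G := topologicalGroup_of_lieGroup 𝓘(ℝ, EG) ∞
  have : LocallyCompactSpace G := Manifold.locallyCompact_of_finiteDimensional 𝓘(ℝ, EG)
  have : LocallyCompactSpace M := Manifold.locallyCompact_of_finiteDimensional 𝓘(ℝ, E)
  let _ : MeasurableSpace G := borel G
  have : BorelSpace G := ⟨rfl⟩
  have hsmul : ∀ g : G, ContMDiff 𝓘(ℝ, E) 𝓘(ℝ, E) ∞ fun y : M => g • y := fun g =>
    (ContMDiffSMul.contMDiff_smul (I := 𝓘(ℝ, EG)) (I' := 𝓘(ℝ, E)) (G := G) (M := M)).comp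
      (contMDiff_const.prodMk contMDiff_id)
  have : IsIsometricSMul G M := isIsometricSMul_of_norm_mfderiv_eq
    (fun g => (hsmul g).of_le (by exact_mod_cast le_top)) hisom
  have hcpt : ∀ (x : M) (ρ : ℝ), IsCompact (Metric.closedEBall x (ENNReal.ofReal ρ)) :=
    (IsRiemannianManifold.isLengthMetric E M).isCompact_closedEBall
  obtain ⟨x₀⟩ : Nonempty M := hconn.toNonempty.map Quotient.out
  have : SigmaCompactSpace (MulAction.orbitRel.Quotient G M) := sigmaCompactSpace_quotient hcpt x₀
  have : T2Space (MulAction.orbitRel.Quotient G M) := t2Space_quotient_mulAction_of_properSMul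
  obtain ⟨f, hf, hinv, hnear, hgrad⟩ := exists_smooth_invariant_near (G := G)
    MeasureTheory.Measure.haar EG hisom (lipschitzWith_orbitDist G x₀)
    (fun g x => orbitDist_smul x₀ g x)
  have hlt : ∀ L x, L + 1 < orbitDist G x₀ x → L < |f x| := fun L x hx => by
    have := (abs_le.1 (hnear x)).1
    have := le_abs_self (f x)
    linarith
  obtain ⟨u, hu⟩ := HigsonCorona.exists_units_of_gradBound (G := G) (by norm_num) hf hinv
    (fun L => ⟨_, isCocompact_orbitDist_le hcpt x₀ (L + 1), fun x hx => hlt L x (not_le.1 hx)⟩)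
    hgrad
  refine HigsonCorona.uncountable_K1_of_unbounded E M G
    (f := fun x => Real.log (1 + f x ^ 2)) ?_ (fun g x => by simp only [hinv]) (fun C => ?_) u hu
  · exact (continuous_const.add (hf.continuous.pow 2)).log fun x =>
      show 1 + f x ^ 2 ≠ 0 by positivity
  -- The extra 1 absorbs the distance between f and r, so |f| > exp C; then 1 + f² ≥ 2|f| > exp C.
  · obtain ⟨x, hx⟩ := exists_lt_orbitDist G hcpt x₀ (Real.exp C + 1)
    refine ⟨x, lt_of_lt_of_le ?_ (le_abs_self _)⟩
    rw [Real.lt_log_iff_exp_lt (by positivity), ← sq_abs]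
    nlinarith [hlt _ x hx, sq_nonneg (|f x| - 1)]
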